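/- **Setting.** There are two players $i\in I=\{1,2\}$, with $-i$ the opponent of $i$. Player $i$ has a finite set $A_i$ of at least two actions and a utility $u_i:A=A_1\times A_2\to\mathbb R$. An action $a_i'$ is *absolutely dominated* if there is $a_i\in A_i$ with $\min_{a_{-i}\in A_{-i}}u_i(a_i,a_{-i})>\max_{a_{-i}\in A_{-i}}u_i(a_i',a_{-i})$. **Interdependent-choice equilibrium.** Given $\alpha\in\Delta(A)$ and $\theta:A\to\Delta(I)$, the mediated game is played as follows. A mediator draws $a^*\sim\alpha$ and then a first mover $i^*\sim\theta(\cdot|a^*)$. She privately recommends $a^*_{i^*}$ to $i^*$ and observes his action $a_{i^*}$. She then privately recommends to $-i^*$ the action $a^*_{-i^*}$ if $a_{i^*}=a^*_{i^*}$, and otherwise an element of $\arg\min_{b\in A_{-i^*}}u_{i^*}(a_{i^*},b)$. A player knows only his recommendation when he acts. The distribution $\alpha$ is an *interdependent-choice equilibrium* if for some $\theta$ following the recommendations is a Nash equilibrium; equivalently, for all $i$ and $a_i,a_i'\in A_i$, $$\sum_{a_{-i}}\alpha(a)\Big(u_i(a)-(1-\theta(i|a))\,u_i(a_i',a_{-i})-\theta(i|a)\min_{b\in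 A_{-i}}u_i(a_i',b)\Big)\ge 0 .$$ **Quasi-sequential equilibrium.** Consider finite extensive form games with perfect recall played by the two players and Nature, where Nature may give probability zero to some of her available moves. Let $\sigma$ be a profile of mixed strategies and $\psi$ a system of beliefs, which specifies for each information set of each player a distribution over its nodes. The pair $(\psi,\sigma)$ is a *quasi-sequential equilibrium* if it satisfies two conditions. 1. *Weak consistency*: for each player $i$ separately there is a sequence of strictly mixed strategies of the players and of Nature that converges to $\sigma$ and to Nature's actual choice probabilities, and for which the beliefs of $i$ obtained by Bayes' rule converge to $\psi_i$. 2. *Sequential rationality*: at every information set of every player $i$, each pure strategy of positive probability under $\sigma_i$ prescribes a move that maximizes the expected payoff of $i$ given $\psi_i$, future choices being made according to $\sigma$ and Nature's choice probabilities. Here a player's future choices at a node are taken conditional on his own earlier moves on the way to that node. If these have probability zero under his mixed strategy, the unconditional probabilities of the pure strategies are used. **Mechanisms.** An *extensive form mechanism* is such a game together with a map $\tau$ from terminal nodes onto $A$ such that the payoffs at each terminal node $z$ are $u(\tau(z))$, and such that the two conditions below hold. A move $m$ available at a decision node $y$ of $i$ *represents* $a_i\in A_i$ at $y$ if every terminal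 node $z$ after $(y,m)$ has $\tau_i(z)=a_i$ and some terminal node $z$ after $y$ has $\tau_i(z)\neq a_i$. The node $y$ is *pivotal* for $i$ if every action of $i$ is represented by some move at $y$. The conditions are: 1. the relation "represents" is the same at all nodes of an information set; 2. for every terminal node $z$ and every player $i$, on the path to $z$ player $i$ makes, at a pivotal node for $i$, a move that represents $\tau_i(z)$. A distribution $\alpha\in\Delta(A)$ is *quasi-sequentially implementable* if it is the distribution of $\tau(z)$ induced by some quasi-sequential equilibrium of some extensive form mechanism. **Statement.** If no action of either player is absolutely dominated, then a distribution $\alpha\in\Delta(A)$ is quasi-sequentially implementable if and only if it is an interdependent-choice equilibrium. -/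

import Mathlib

open Filter Topology

universe u

noncomputable section

/-- The two players. The opponent of `i` is `!i`. -/
abbrev Player := Bool

/-! ### The environment: finite action sets `A i` and utilities `u i` on action profiles -/

/-- The action profile in which `i` chooses `x` and the opponent of `i` chooses `b`. -/
def joinProfile {A : Player → Type u} : (i : Player) → A i → A (!i) → (∀ j, A j)
  | true, x, b => fun j => match j with
    | true => x
    | false => b
  | false, x, b => fun j => match j with
    | true => b
    | false => x

/-- The action `x` of player `i` absolutely dominates the action `y`: the worst payoff from `x`
is strictly larger than the best payoff from `y`. -/
def AbsolutelyDominates {A : Player → Type u} (u : Player → (∀ j, A j) → ℝ)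
    (i : Player) (x y : A i) : Prop :=
  ∀ b c : A (!i), u i (joinProfile i y c) < u i (joinProfile i x b)

/-- No action of any player is absolutely dominated. -/
def NoAbsolutelyDominated {A : Player → Type u} (u : Player → (∀ j, A j) → ℝ) : Prop :=
  ∀ (i : Player) (y : A i), ¬ ∃ x : A i, AbsolutelyDominates u i x y

/-! ### Mediated games and interdependent-choice equilibrium -/

section Mediated

variable {A : Player → Type u} [∀ i, Fintype (A i)]

/-- The effective credible threats `B_j ∪ supp α_j` of player `j`. -/
def effectiveThreats (α : (∀ j, A j) → ℝ) (B : ∀ j, Set (A j)) (j : Player) : Set (A j) :=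
  B j ∪ {x | ∃ a : ∀ k, A k, 0 < α a ∧ a j = x}

/-- `p i x` is the action recommended to the second mover `!i` after the first mover `i` deviated
to `x`; it has to be one of the worst available punishments for `i`. -/
def IsPunishmentRule (u : Player → (∀ j, A j) → ℝ) (α : (∀ j, A j) → ℝ)
    (B : ∀ j, Set (A j)) (p : ∀ i : Player, A i → A (!i)) : Prop :=
  ∀ (i : Player) (x : A i), p i x ∈ effectiveThreats α B (!i) ∧
    ∀ b ∈ effectiveThreats α B (!i), u i (joinProfile i x (p i x)) ≤ u i (joinProfile i x b)

open Classical in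
/-- The action profile played in the mediated game when the mediator intends `a`, player `i` is
visited first, and each player `j` answers the recommendation `r` by the action `s j r`. -/
def mediatedOutcome (p : ∀ i : Player, A i → A (!i)) (s : ∀ j, A j → A j)
    (a : ∀ j, A j) (i : Player) : ∀ j, A j :=
  joinProfile i (s i (a i)) (s (!i) (if s i (a i) = a i then a (!i) else p i (s i (a i))))

/-- Expected payoff of player `j` in the mediated game under the strategies `s`. -/
def mediatedPayoff (u : Player → (∀ j, A j) → ℝ) (α : (∀ j, A j) → ℝ)
    (θ : (∀ j, A j) → Player → ℝ) (p : ∀ i : Player, A i → A (!i))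
    (s : ∀ j, A j → A j) (j : Player) : ℝ :=
  ∑ a : ∀ k, A k, ∑ i : Player, α a * θ a i * u j (mediatedOutcome p s a i)

/-- `α` is an interdependent-choice equilibrium with respect to the credible threats `B`: for some
conditional distribution `θ` of the first mover, following the recommendations is a Nash
equilibrium of the mediated game. -/
def IsICEWith (u : Player → (∀ j, A j) → ℝ) (B : ∀ j, Set (A j)) (α : (∀ j, A j) → ℝ) : Prop :=
  α ∈ stdSimplex ℝ (∀ j, A j) ∧
  ∃ (θ : (∀ j, A j) → Player → ℝ) (p : ∀ i : Player, A i → A (!i)),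
    (∀ a, θ a ∈ stdSimplex ℝ Player) ∧ IsPunishmentRule u α B p ∧
    ∀ (j : Player) (d : A j → A j),
      mediatedPayoff u α θ p (Function.update (fun _ => id) j d) j ≤
        mediatedPayoff u α θ p (fun _ => id) j

/-- Interdependent-choice equilibrium: all actions are credible threats. -/
def IsICE (u : Player → (∀ j, A j) → ℝ) (α : (∀ j, A j) → ℝ) : Prop :=
  IsICEWith u (fun _ => Set.univ) α

end Mediated

/-! ### Finite extensive form games with perfect recall

A node is the list of the moves made so far, the most recent move first. So `m :: x` is the node
reached from `x` by the move `m`, and `x <:+ z` says that `x` precedes or equals `z`. -/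

open Classical in
/-- The record of player `i` at a node: the information sets (given by their labels) at which
he has moved and the moves he has made there, the most recent first. -/
def experienceOf {M L : Type u} (mover : List M → Option Player) (label : List M → L)
    (i : Player) : List M → List (L × M)
  | [] => []
  | m :: x => if mover x = some i then (label x, m) :: experienceOf mover label i x
      else experienceOf mover label i x

/-- A finite extensive form game with perfect recall. The information sets of player `i` are the
classes of his decision nodes that have the same label. The functions `mover`, `label` and
`chance` matter at nonterminal nodes only, `payoff` at terminal nodes only; `none` is Nature.
Nature may give probability zero to available moves. -/
structure ExtensiveGame (M L : Type u) where
  nodes : Finset (List M)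
  root_mem : [] ∈ nodes
  mem_of_cons_mem : ∀ (x : List M) (m : M), m :: x ∈ nodes → x ∈ nodes
  mover : List M → Option Player
  label : List M → L
  chance : List M → M → ℝ
  payoff : Player → List M → ℝ
  same_moves : ∀ (i : Player) (x y : List M) (m m' : M), m :: x ∈ nodes → m' :: y ∈ nodes →
    mover x = some i → mover y = some i → label x = label y →
    ∀ m'' : M, m'' :: x ∈ nodes ↔ m'' :: y ∈ nodes
  perfect_recall : ∀ (i : Player) (x y : List M) (m m' : M), m :: x ∈ nodes → m' :: y ∈ nodes →
    mover x = some i → mover y = some i → label x = label y →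
    experienceOf mover label i x = experienceOf mover label i y
  chance_nonneg : ∀ (x : List M) (m : M), m :: x ∈ nodes → mover x = none → 0 ≤ chance x m
  chance_sum : ∀ (x : List M) (m : M), m :: x ∈ nodes → mover x = none →
    ∑ m' ∈ nodes.preimage (fun m' => m' :: x) (fun _ _ _ _ h => (List.cons.inj h).1),
      chance x m' = 1

namespace ExtensiveGame

variable {M L : Type u} (G : ExtensiveGame M L)

/-- The moves available at a node. -/
def moves (x : List M) : Finset M :=
  G.nodes.preimage (fun m => m :: x) (fun _ _ _ _ h => (List.cons.inj h).1)

open Classical in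
def terminal : Finset (List M) := G.nodes.filter fun x => G.moves x = ∅

open Classical in
/-- The decision nodes of an agent (`none` is Nature). -/
def decisionNodes (k : Option Player) : Finset (List M) :=
  G.nodes.filter fun x => (G.moves x).Nonempty ∧ G.mover x = k

open Classical in
/-- The (labels of the) information sets of player `i`. -/
def infoSets (i : Player) : Finset L := (G.decisionNodes (some i)).image G.label

open Classical in
/-- The nodes of the information set of player `i` with label `h`. -/
def cell (i : Player) (h : L) : Finset (List M) :=
  (G.decisionNodes (some i)).filter fun x => G.label x = h

open Classical in
/-- The moves available at an information set. -/
def infoMoves (i : Player) (h : L) : Finset M := (G.cell i h).biUnion G.moves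

/-- A pure strategy of player `i`: an available move at each of his information sets. -/
def PureStrategy (i : Player) : Type u :=
  (h : {h : L // h ∈ G.infoSets i}) → {m : M // m ∈ G.infoMoves i h.1}

instance (i : Player) : Finite (G.PureStrategy i) := by
  unfold PureStrategy; infer_instance

instance (i : Player) : Fintype (G.PureStrategy i) := Fintype.ofFinite _

/-- A profile of mixed strategies: a weight for each pure strategy. -/
abbrev StrategyProfile : Type u := ∀ i : Player, G.PureStrategy i → ℝ

def IsMixed (σ : G.StrategyProfile) : Prop := ∀ i, σ i ∈ stdSimplex ℝ (G.PureStrategy i)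

def IsStrictlyMixed (σ : G.StrategyProfile) : Prop := G.IsMixed σ ∧ ∀ i s, 0 < σ i s

/-- A strictly mixed strategy of Nature: independent choices at the nodes of Nature, each
available move having positive probability. -/
def IsStrictlyMixedNature (χ : List M → M → ℝ) : Prop :=
  ∀ x ∈ G.decisionNodes none, (∀ m ∈ G.moves x, 0 < χ x m) ∧ ∑ m ∈ G.moves x, χ x m = 1

variable {G} in
/-- The pure strategy `s` prescribes the move `m` at the node `x`. -/
def Prescribes {i : Player} (s : G.PureStrategy i) (x : List M) (m : M) : Prop :=
  ∀ h : {h : L // h ∈ G.infoSets i}, h.1 = G.label x → (s h).1 = m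

variable {G} in
/-- All moves of player `i` on the way to the node are those prescribed by `s`. -/
def AllowsNode {i : Player} (s : G.PureStrategy i) : List M → Prop
  | [] => True
  | m :: x => AllowsNode s x ∧ (G.mover x = some i → Prescribes s x m)

open Classical in
variable {G} in
/-- The probability of a set of pure strategies under a mixed strategy. -/
def strategyProb {i : Player} (σ : G.PureStrategy i → ℝ) (P : G.PureStrategy i → Prop) : ℝ :=
  ∑ s, if P s then σ s else 0

open Classical in
/-- The probability of Nature making all her moves on the way to a node. -/
def natureProb (χ : List M → M → ℝ) : List M → ℝ
  | [] => 1
  | m :: x => natureProb χ x * (if G.mover x = none then χ x m else 1)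

/-- The probability of reaching the node `x` under `σ` and Nature's choices `χ`. -/
def reachProb (σ : G.StrategyProfile) (χ : List M → M → ℝ) (x : List M) : ℝ :=
  G.natureProb χ x * ∏ i : Player, strategyProb (σ i) (fun s => AllowsNode s x)

open Classical in
/-- The probability that the agent moving at `x` chooses `m` there. For a player it is conditional
on his own earlier moves; if these have probability zero under his mixed strategy, it is the
unconditional probability of the pure strategies that prescribe `m`. -/
def stepProb (σ : G.StrategyProfile) (x : List M) (m : M) : ℝ :=
  match G.mover x with
  | none => G.chance x m
  | some i =>
    if strategyProb (σ i) (fun s => AllowsNode s x) = 0 then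
      strategyProb (σ i) (fun s => Prescribes s x m)
    else
      strategyProb (σ i) (fun s => AllowsNode s x ∧ Prescribes s x m) /
        strategyProb (σ i) (fun s => AllowsNode s x)

open Classical in
/-- The probability of reaching the node `z` when play starts at the node `x`. -/
def continuationProb (σ : G.StrategyProfile) (x : List M) : List M → ℝ
  | [] => if x = [] then 1 else 0
  | m :: z => if x = m :: z then 1 else continuationProb σ x z * G.stepProb σ z m

/-- Expected payoff of player `i` when play starts at the node `x`. -/
def continuationPayoff (σ : G.StrategyProfile) (i : Player) (x : List M) : ℝ :=
  ∑ z ∈ G.terminal, G.continuationProb σ x z * G.payoff i z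

/-- Conditional belief systems: `ψ i h x` is the probability that player `i` assigns at his
information set `h` to being at the node `x`. -/
def IsBeliefSystem (ψ : Player → L → List M → ℝ) : Prop :=
  ∀ i, ∀ h ∈ G.infoSets i,
    (∀ x ∈ G.cell i h, 0 ≤ ψ i h x) ∧ ∑ x ∈ G.cell i h, ψ i h x = 1

/-- Expected payoff of `i` from the move `m` at the information set `h`, given his beliefs and
given that all future choices are made according to `σ`. -/
def interimPayoff (ψ : Player → L → List M → ℝ) (σ : G.StrategyProfile)
    (i : Player) (h : L) (m : M) : ℝ :=
  ∑ x ∈ G.cell i h, ψ i h x * G.continuationPayoff σ i (m :: x)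

/-- The belief at the information set `h` of player `i` given by Bayes rule. -/
def bayesBelief (σ : G.StrategyProfile) (χ : List M → M → ℝ)
    (i : Player) (h : L) (x : List M) : ℝ :=
  G.reachProb σ χ x / ∑ y ∈ G.cell i h, G.reachProb σ χ y

/-- Weak consistency: for each player separately there are strictly mixed strategies of the
players and of Nature that converge to `σ` and to Nature's actual choices, and whose Bayesian
beliefs for that player converge to his beliefs in `ψ`. -/
def WeaklyConsistent (ψ : Player → L → List M → ℝ) (σ : G.StrategyProfile) : Prop :=
  ∀ i : Player, ∃ (σn : ℕ → G.StrategyProfile) (χn : ℕ → List M → M → ℝ),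
    (∀ n, G.IsStrictlyMixed (σn n)) ∧ (∀ n, G.IsStrictlyMixedNature (χn n)) ∧
    (∀ j s, Tendsto (fun n => σn n j s) atTop (𝓝 (σ j s))) ∧
    (∀ x ∈ G.decisionNodes none, ∀ m ∈ G.moves x,
      Tendsto (fun n => χn n x m) atTop (𝓝 (G.chance x m))) ∧
    (∀ h ∈ G.infoSets i, ∀ x ∈ G.cell i h,
      Tendsto (fun n => G.bayesBelief (σn n) (χn n) i h x) atTop (𝓝 (ψ i h x)))

/-- Sequential rationality: at every information set, each pure strategy of positive probability
prescribes an optimal move. -/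
def SequentiallyRational (ψ : Player → L → List M → ℝ) (σ : G.StrategyProfile) : Prop :=
  ∀ (i : Player) (h : {h : L // h ∈ G.infoSets i}) (s : G.PureStrategy i), 0 < σ i s →
    ∀ m ∈ G.infoMoves i h.1,
      G.interimPayoff ψ σ i h.1 m ≤ G.interimPayoff ψ σ i h.1 (s h).1

/-- Quasi-sequential equilibrium. -/
def IsQSE (ψ : Player → L → List M → ℝ) (σ : G.StrategyProfile) : Prop :=
  G.IsBeliefSystem ψ ∧ G.IsMixed σ ∧ G.WeaklyConsistent ψ σ ∧ G.SequentiallyRational ψ σ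

/-! ### Extensive form mechanisms -/

variable {A : Player → Type u}

/-- `τ` is an outcome homomorphism: it maps terminal nodes onto action profiles and preserves
preferences. -/
def IsOutcomeHom (u : Player → (∀ j, A j) → ℝ) (τ : List M → (∀ j, A j)) : Prop :=
  (∀ a, ∃ z ∈ G.terminal, τ z = a) ∧ ∀ z ∈ G.terminal, ∀ i, G.payoff i z = u i (τ z)

/-- The move `m` represents the action `a` of player `i` at the node `x`. -/
def Represents (τ : List M → (∀ j, A j)) (i : Player) (x : List M) (m : M) (a : A i) : Prop :=
  m ∈ G.moves x ∧
  (∀ z ∈ G.terminal, (m :: x) <:+ z → τ z i = a) ∧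
  ∃ m' ∈ G.moves x, ∃ z ∈ G.terminal, (m' :: x) <:+ z ∧ τ z i ≠ a

/-- A decision node of `i` is pivotal if each of his actions is represented by some move there. -/
def IsPivotal (τ : List M → (∀ j, A j)) (i : Player) (x : List M) : Prop :=
  x ∈ G.decisionNodes (some i) ∧ ∀ a : A i, ∃ m, G.Represents τ i x m a

/-- Full disclosure of consequences: which moves represent which actions is the same at all nodes
of an information set. -/
def FullDisclosure (τ : List M → (∀ j, A j)) : Prop :=
  ∀ i, ∀ h ∈ G.infoSets i, ∀ x ∈ G.cell i h, ∀ y ∈ G.cell i h, ∀ (m : M) (a : A i),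
    G.Represents τ i x m a ↔ G.Represents τ i y m a

/-- `(G, τ)` is an extensive form mechanism for the environment: on the way to every terminal
node, each player makes, at a pivotal node, a move that represents his action in the outcome. -/
def IsMechanism (u : Player → (∀ j, A j) → ℝ) (τ : List M → (∀ j, A j)) : Prop :=
  G.IsOutcomeHom u τ ∧ G.FullDisclosure τ ∧
  ∀ z ∈ G.terminal, ∀ i, ∃ x m, G.IsPivotal τ i x ∧ G.Represents τ i x m (τ z i) ∧ (m :: x) <:+ z

end ExtensiveGame

open Classical in
/-- `α` is quasi-sequentially implementable: it is the distribution of outcomes in some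
quasi-sequential equilibrium of some extensive form mechanism. -/
def IsQSImplementable {A : Player → Type u} (u : Player → (∀ j, A j) → ℝ)
    (α : (∀ j, A j) → ℝ) : Prop :=
  ∃ (M L : Type u) (G : ExtensiveGame M L) (τ : List M → (∀ j, A j)),
    G.IsMechanism u τ ∧
    ∃ (ψ : Player → L → List M → ℝ) (σ : G.StrategyProfile), G.IsQSE ψ σ ∧
      ∀ a, α a = ∑ z ∈ G.terminal, if τ z = a then G.reachProb σ G.chance z else 0

end

/-! Necessity. Along the path to a terminal node, each player settles his action by a pivotal move,
and there is only one such move, because afterwards no alternative action is left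
(`Represents.unique`). Hence one of the two players settles first (`movesFirst_or`), and `θ` can be
taken as the conditional law of this first player given the outcome. Suppose that player `i`
represents `a'` at the node where he should represent `a`. His own action is then `a'` whatever
happens later. If his opponent has already settled, the opponent's action is unchanged; otherwise
`i` gets at least his worst payoff from `a'`. These are the deviation payoffs of the mediated game,
or lower bounds for what the deviation yields in the mechanism. Beliefs satisfy Bayes' rule at
reached information sets, so sequential rationality can be weighted by reach probabilities and
summed over information sets (`sum_cell_gain_nonneg`, `sum_terminal_gain_nonneg`), which gives the
Nash inequalities.

Sufficiency. The mechanism is the mediated game itself. Nature may draw every pair of first mover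
and intended profile, with actual probabilities `α a * θ a i`, and the information sets of a player
are his possible recommendations. At a recommendation of positive probability, beliefs are Bayesian
and obedience is optimal by the Nash condition (`sum_cell_follow`, `continuationPayoff_pathNode`).
At an unexpected recommendation `r`, the player is certain that he moves first and that obedience
will be answered by the action of the opponent that is best for him. Obedience then yields `max
u_i(r, ·)`, and a deviation to `y` yields `min u_i(y, ·)`. The latter is not larger, because `y`
does not absolutely dominate `r` (`sum_beliefWeight_le`). Thus even an incredible punishment is
carried out: the punisher does not believe that he is punishing. Trembles that make these optimistic
draws far more likely than all other surprises generate the beliefs (`weaklyConsistent`). They can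
be chosen for each player separately, which is all that weak consistency asks. -/

namespace ExtensiveGame

variable {M L : Type u} (G : ExtensiveGame M L)

/-! ### Nodes, moves and information sets -/

theorem mem_moves {x : List M} {m : M} : m ∈ G.moves x ↔ m :: x ∈ G.nodes :=
  Finset.mem_preimage

theorem mem_nodes_of_suffix {x z : List M} (hz : z ∈ G.nodes) (h : x <:+ z) : x ∈ G.nodes := by
  induction z with
  | nil => exact List.suffix_nil.1 h ▸ hz
  | cons m z ih =>
    rcases List.suffix_cons_iff.1 h with rfl | h
    · exact hz
    · exact ih (G.mem_of_cons_mem _ _ hz) h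

theorem mem_terminal {z : List M} : z ∈ G.terminal ↔ z ∈ G.nodes ∧ G.moves z = ∅ := by
  simp [terminal]

theorem mem_decisionNodes {k : Option Player} {x : List M} :
    x ∈ G.decisionNodes k ↔ (G.moves x).Nonempty ∧ G.mover x = k := by
  simp only [decisionNodes, Finset.mem_filter, and_iff_right_iff_imp]
  rintro ⟨⟨m, hm⟩, -⟩
  exact G.mem_of_cons_mem _ _ (G.mem_moves.1 hm)

theorem mem_cell {i : Player} {h : L} {x : List M} :
    x ∈ G.cell i h ↔ x ∈ G.decisionNodes (some i) ∧ G.label x = h := by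
  simp [cell]

theorem mem_infoSets {i : Player} {h : L} :
    h ∈ G.infoSets i ↔ ∃ x ∈ G.decisionNodes (some i), G.label x = h := by
  simp [infoSets]

theorem mem_infoMoves {i : Player} {h : L} {x : List M} (hx : x ∈ G.cell i h) {m : M} :
    m ∈ G.infoMoves i h ↔ m ∈ G.moves x := by
  classical
  refine ⟨fun hm => ?_, fun hm => Finset.mem_biUnion.2 ⟨x, hx, hm⟩⟩
  obtain ⟨y, hy, hm⟩ := Finset.mem_biUnion.1 hm
  obtain ⟨hxd, hxl⟩ := G.mem_cell.1 hx
  obtain ⟨hyd, hyl⟩ := G.mem_cell.1 hy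
  obtain ⟨⟨n, hn⟩, hxm⟩ := G.mem_decisionNodes.1 hxd
  obtain ⟨⟨n', hn'⟩, hym⟩ := G.mem_decisionNodes.1 hyd
  rw [mem_moves] at *
  exact (G.same_moves i x y n n' hn hn' hxm hym (hxl.trans hyl.symm) m).2 hm

theorem exists_cons_suffix {x z : List M} (h : x <:+ z) (hne : x ≠ z) : ∃ m, (m :: x) <:+ z := by
  obtain ⟨t, rfl⟩ := h
  rcases List.eq_nil_or_concat t with rfl | ⟨t, m, rfl⟩
  · simp at hne
  · exact ⟨m, t, by simp⟩

theorem cons_suffix_unique {x z : List M} {m m' : M} (h : (m :: x) <:+ z) (h' : (m' :: x) <:+ z) :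
    m = m' := by
  rcases List.suffix_or_suffix_of_suffix h h' with h | h
  · exact (List.cons.inj (h.eq_of_length (by simp))).1
  · exact (List.cons.inj (h.eq_of_length (by simp))).1.symm

open Classical in
/-- The terminal nodes that follow or equal a node. -/
noncomputable def terminalAfter (x : List M) : Finset (List M) := G.terminal.filter (x <:+ ·)

theorem mem_terminalAfter {x z : List M} :
    z ∈ G.terminalAfter x ↔ z ∈ G.terminal ∧ x <:+ z := by
  simp [terminalAfter]

theorem terminalAfter_of_mem_terminal {x : List M} (hx : x ∈ G.terminal) :
    G.terminalAfter x = {x} := by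
  ext z
  rw [mem_terminalAfter, Finset.mem_singleton]
  refine ⟨fun ⟨hz, hxz⟩ => ?_, by rintro rfl; exact ⟨hx, List.suffix_rfl⟩⟩
  by_contra hne
  obtain ⟨m, hm⟩ := exists_cons_suffix hxz (Ne.symm hne)
  have := G.mem_moves.2 (G.mem_nodes_of_suffix (G.mem_terminal.1 hz).1 hm)
  rw [(G.mem_terminal.1 hx).2] at this
  simp at this

/-- Conservation of flow: a quantity that is split among the moves at each nonterminal node after
`x` is the sum of its values at the terminal nodes after `x`. -/
theorem flow_eq_sum_terminalAfter (F : List M → ℝ) {x : List M} (hx : x ∈ G.nodes)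
    (hF : ∀ y, x <:+ y → (G.moves y).Nonempty → F y = ∑ m ∈ G.moves y, F (m :: y)) :
    F x = ∑ z ∈ G.terminalAfter x, F z := by
  classical
  obtain ⟨N, hN⟩ : ∃ N, ∀ y ∈ G.nodes, y.length ≤ N :=
    ⟨G.nodes.sup List.length, fun y hy => Finset.le_sup (f := List.length) hy⟩
  -- Backward induction: `n` bounds the number of moves that can still follow `x`.
  suffices H : ∀ n x, x ∈ G.nodes → N ≤ x.length + n →
      (∀ y, x <:+ y → (G.moves y).Nonempty → F y = ∑ m ∈ G.moves y, F (m :: y)) →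
      F x = ∑ z ∈ G.terminalAfter x, F z from H N x hx (by omega) hF
  intro n
  induction n with
  | zero =>
    intro x hx hl _
    have hter : x ∈ G.terminal := by
      refine G.mem_terminal.2 ⟨hx, Finset.eq_empty_of_forall_notMem fun m hm => ?_⟩
      have := hN _ (G.mem_moves.1 hm)
      simp at this
      omega
    rw [G.terminalAfter_of_mem_terminal hter, Finset.sum_singleton]
  | succ n ih =>
    intro x hx hl hF
    by_cases hm : (G.moves x).Nonempty
    · have hdec : G.terminalAfter x = (G.moves x).biUnion fun m => G.terminalAfter (m :: x) := by
        ext z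
        simp only [Finset.mem_biUnion, mem_terminalAfter]
        constructor
        · rintro ⟨hz, hxz⟩
          have hne : x ≠ z := by
            rintro rfl
            rw [(G.mem_terminal.1 hz).2] at hm
            simp at hm
          obtain ⟨m, hm⟩ := exists_cons_suffix hxz hne
          exact ⟨m, G.mem_moves.2 (G.mem_nodes_of_suffix (G.mem_terminal.1 hz).1 hm), hz, hm⟩
        · rintro ⟨m, -, hz, hmz⟩
          exact ⟨hz, (List.suffix_cons m x).trans hmz⟩
      rw [hdec, Finset.sum_biUnion, hF x List.suffix_rfl hm]
      · refine Finset.sum_congr rfl fun m hm => ih _ (G.mem_moves.1 hm) (by simp; omega) ?_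
        exact fun y hy => hF y ((List.suffix_cons m x).trans hy)
      · intro m _ m' _ hne
        refine Finset.disjoint_left.2 fun z hz hz' => hne ?_
        exact cons_suffix_unique (G.mem_terminalAfter.1 hz).2 (G.mem_terminalAfter.1 hz').2
    · have hter : x ∈ G.terminal := G.mem_terminal.2 ⟨hx, Finset.not_nonempty_iff_eq_empty.1 hm⟩
      rw [G.terminalAfter_of_mem_terminal hter, Finset.sum_singleton]

/-! ### Probabilities of sets of pure strategies -/

section StrategyProb

variable {G} {i : Player} {σ : G.PureStrategy i → ℝ}

theorem strategyProb_nonneg (h : ∀ s, 0 ≤ σ s) (P : G.PureStrategy i → Prop) :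
    0 ≤ strategyProb σ P :=
  Finset.sum_nonneg fun s _ => by split_ifs <;> simp [h]

theorem strategyProb_mono (h : ∀ s, 0 ≤ σ s) {P Q : G.PureStrategy i → Prop}
    (hPQ : ∀ s, P s → Q s) : strategyProb σ P ≤ strategyProb σ Q := by
  refine Finset.sum_le_sum fun s _ => ?_
  by_cases hP : P s
  · simp [hP, hPQ s hP]
  · simp only [hP, if_false]
    split_ifs <;> simp [h]

theorem strategyProb_true (h : ∑ s, σ s = 1) {P : G.PureStrategy i → Prop} (hP : ∀ s, P s) :
    strategyProb σ P = 1 := by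
  simp [strategyProb, hP, h]

theorem exists_pos_of_strategyProb_pos {P : G.PureStrategy i → Prop} (h : 0 < strategyProb σ P) :
    ∃ s, P s ∧ 0 < σ s := by
  obtain ⟨s, -, hs⟩ := Finset.exists_lt_of_sum_lt (s := Finset.univ) (f := fun _ => (0 : ℝ))
    (by simpa [strategyProb] using h)
  by_cases hP : P s
  · exact ⟨s, hP, by simpa [hP] using hs⟩
  · simp [hP] at hs

open Classical in
theorem strategyProb_single (s : G.PureStrategy i) (P : G.PureStrategy i → Prop) :
    strategyProb (Pi.single s 1) P = if P s then 1 else 0 := by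
  rw [strategyProb, Finset.sum_eq_single s] <;> simp +contextual

/-- Each pure strategy selects a single `k`, so the events `Q · k` partition `P`. Used with the move
prescribed at a node. -/
theorem sum_strategyProb_and (P : G.PureStrategy i → Prop) {κ : Type*} (t : Finset κ)
    (Q : G.PureStrategy i → κ → Prop) (hQ : ∀ s, ∃! k, k ∈ t ∧ Q s k) :
    ∑ k ∈ t, strategyProb σ (fun s => P s ∧ Q s k) = strategyProb σ P := by
  classical
  simp only [strategyProb]
  rw [Finset.sum_comm]
  refine Finset.sum_congr rfl fun s _ => ?_
  obtain ⟨k, ⟨hk, hQk⟩, huniq⟩ := hQ s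
  rw [Finset.sum_eq_single k]
  · simp [hQk]
  · intro k' hk' hne
    exact if_neg fun h => hne (huniq k' ⟨hk', h.2⟩)
  · exact fun h => absurd hk h

theorem prescribes_iff {s : G.PureStrategy i} {x : List M} {m : M}
    (hx : G.label x ∈ G.infoSets i) : Prescribes s x m ↔ (s ⟨G.label x, hx⟩).1 = m := by
  refine ⟨fun h => h _ rfl, ?_⟩
  rintro h ⟨l, hl⟩ rfl
  exact h

theorem label_mem_infoSets {x : List M} (hx : x ∈ G.decisionNodes (some i)) :
    G.label x ∈ G.infoSets i := G.mem_infoSets.2 ⟨x, hx, rfl⟩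

theorem existsUnique_prescribes (s : G.PureStrategy i) {x : List M}
    (hx : x ∈ G.decisionNodes (some i)) : ∃! m, m ∈ G.moves x ∧ Prescribes s x m := by
  have hl := label_mem_infoSets hx
  refine ⟨(s ⟨_, hl⟩).1, ⟨?_, (prescribes_iff hl).2 rfl⟩, fun m hm => ?_⟩
  · exact (G.mem_infoMoves (G.mem_cell.2 ⟨hx, rfl⟩)).1 (s ⟨_, hl⟩).2
  · exact ((prescribes_iff hl).1 hm.2).symm

/-- Only the player's own record matters. Perfect recall then makes `AllowsNode s` constant on
information sets. -/
theorem allowsNode_iff (s : G.PureStrategy i) (x : List M) :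
    AllowsNode s x ↔ ∀ e ∈ experienceOf G.mover G.label i x,
      ∀ h : {h : L // h ∈ G.infoSets i}, h.1 = e.1 → (s h).1 = e.2 := by
  induction x with
  | nil => simp [AllowsNode, experienceOf]
  | cons m x ih =>
    rw [AllowsNode, experienceOf, ih]
    by_cases hx : G.mover x = some i
    · simp only [hx, if_true, List.forall_mem_cons, Prescribes, true_imp_iff]
      exact and_comm
    · simp [hx]

theorem allowsNode_congr (s : G.PureStrategy i) {h : L} {x y : List M} (hx : x ∈ G.cell i h)
    (hy : y ∈ G.cell i h) : AllowsNode s x ↔ AllowsNode s y := by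
  obtain ⟨hxd, hxl⟩ := G.mem_cell.1 hx
  obtain ⟨hyd, hyl⟩ := G.mem_cell.1 hy
  obtain ⟨⟨n, hn⟩, hxm⟩ := G.mem_decisionNodes.1 hxd
  obtain ⟨⟨n', hn'⟩, hym⟩ := G.mem_decisionNodes.1 hyd
  rw [mem_moves] at *
  rw [allowsNode_iff, allowsNode_iff,
    G.perfect_recall i x y n n' hn hn' hxm hym (hxl.trans hyl.symm)]

end StrategyProb

/-! ### Probabilities of nodes -/

section Prob

variable {G} {σ : G.StrategyProfile}

theorem stepProb_nonneg (hσ : G.IsMixed σ) {x : List M} {m : M} (hx : m :: x ∈ G.nodes) :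
    0 ≤ G.stepProb σ x m := by
  unfold stepProb
  split
  · exact G.chance_nonneg x m hx ‹_›
  · rename_i i _
    have := fun P => strategyProb_nonneg (hσ i).1 P
    split_ifs
    · exact this _
    · exact div_nonneg (this _) (this _)

theorem sum_stepProb (hσ : G.IsMixed σ) {x : List M} (hx : (G.moves x).Nonempty) :
    ∑ m ∈ G.moves x, G.stepProb σ x m = 1 := by
  unfold stepProb
  split
  · obtain ⟨m, hm⟩ := hx
    exact G.chance_sum x m (G.mem_moves.1 hm) ‹_›
  · rename_i i hi
    have hd : x ∈ G.decisionNodes (some i) := G.mem_decisionNodes.2 ⟨hx, hi⟩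
    have hu := fun s : G.PureStrategy i => existsUnique_prescribes s hd
    split_ifs with h0
    · have := sum_strategyProb_and (σ := σ i) (fun _ => True) _ _ hu
      simp only [true_and] at this
      rw [this, strategyProb_true (hσ i).2 fun _ => trivial]
    · rw [← Finset.sum_div, sum_strategyProb_and _ _ _ hu, div_self h0]

/-- Allows the probability of a move to be factored out of a sum over an information set. -/
theorem stepProb_congr (i : Player) {h : L} {x y : List M} (hx : x ∈ G.cell i h)
    (hy : y ∈ G.cell i h) (m : M) : G.stepProb σ x m = G.stepProb σ y m := by
  obtain ⟨hxd, hxl⟩ := G.mem_cell.1 hx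
  obtain ⟨hyd, hyl⟩ := G.mem_cell.1 hy
  have hP : ∀ s : G.PureStrategy i, Prescribes s x m ↔ Prescribes s y m := fun s => by
    simp only [Prescribes, hxl, hyl]
  have hA := fun s : G.PureStrategy i => allowsNode_congr s hx hy
  unfold stepProb
  rw [(G.mem_decisionNodes.1 hxd).2, (G.mem_decisionNodes.1 hyd).2]
  simp only [hP, hA]

theorem natureProb_nonneg {χ : List M → M → ℝ}
    (hχ : ∀ x m, m :: x ∈ G.nodes → G.mover x = none → 0 ≤ χ x m) {x : List M}
    (hx : x ∈ G.nodes) : 0 ≤ G.natureProb χ x := by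
  induction x with
  | nil => simp [natureProb]
  | cons m x ih =>
    refine mul_nonneg (ih (G.mem_of_cons_mem _ _ hx)) ?_
    split_ifs with h
    · exact hχ x m hx h
    · exact zero_le_one

theorem reachProb_nonneg (hσ : G.IsMixed σ) {χ : List M → M → ℝ}
    (hχ : ∀ x m, m :: x ∈ G.nodes → G.mover x = none → 0 ≤ χ x m) {x : List M}
    (hx : x ∈ G.nodes) : 0 ≤ G.reachProb σ χ x :=
  mul_nonneg (natureProb_nonneg hχ hx)
    (Finset.prod_nonneg fun i _ => strategyProb_nonneg (hσ i).1 _)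

theorem strategyProb_allowsNode_cons_of_ne {i : Player} {σ : G.PureStrategy i → ℝ} {x : List M}
    {m : M} (h : G.mover x ≠ some i) :
    strategyProb σ (fun s => AllowsNode s (m :: x)) = strategyProb σ (fun s => AllowsNode s x) := by
  simp [AllowsNode, h]

theorem prod_player (i : Player) (f : Player → ℝ) : ∏ j, f j = f i * f (!i) := by
  cases i <;> simp [mul_comm]

theorem reachProb_cons (hσ : G.IsMixed σ) (x : List M) (m : M) :
    G.reachProb σ G.chance (m :: x) = G.reachProb σ G.chance x * G.stepProb σ x m := by
  rcases hx : G.mover x with _ | i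
  · have := fun i => strategyProb_allowsNode_cons_of_ne (σ := σ i) (m := m) (i := i) (x := x)
      (by simp [hx])
    simp only [reachProb, natureProb, stepProb, this, hx, if_true]
    ring
  · have h2 := strategyProb_allowsNode_cons_of_ne (σ := σ (!i)) (m := m) (i := !i) (x := x)
      (by simp [hx])
    simp only [reachProb, natureProb, stepProb, hx, prod_player i, h2]
    simp only [AllowsNode, hx, true_imp_iff, reduceCtorEq, if_false]
    have hle : strategyProb (σ i) (fun s => AllowsNode s x ∧ Prescribes s x m) ≤
        strategyProb (σ i) (fun s => AllowsNode s x) :=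
      strategyProb_mono (hσ i).1 fun s h => h.1
    have h0 := strategyProb_nonneg (hσ i).1 (fun s => AllowsNode s x ∧ Prescribes s x m)
    -- Where the player's own earlier moves have probability zero, the convention in `stepProb` is
    -- harmless: both sides vanish.
    split_ifs with h
    · rw [h] at hle ⊢
      rw [le_antisymm hle h0]
      ring
    · field_simp

theorem continuationProb_self (x : List M) : G.continuationProb σ x x = 1 := by
  cases x <;> simp [continuationProb]

theorem continuationProb_cons {x z : List M} {m : M} (h : x <:+ z) :
    G.continuationProb σ x (m :: z) = G.continuationProb σ x z * G.stepProb σ z m := by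
  rw [continuationProb, if_neg]
  rintro rfl
  simpa using h.length_le

theorem continuationProb_of_not_suffix {x z : List M} (h : ¬ x <:+ z) :
    G.continuationProb σ x z = 0 := by
  induction z with
  | nil =>
    rw [continuationProb, if_neg]
    rintro rfl
    exact h List.suffix_rfl
  | cons m z ih =>
    rw [continuationProb, if_neg, ih fun h' => h (h'.trans (List.suffix_cons m z)), zero_mul]
    rintro rfl
    exact h List.suffix_rfl

theorem continuationProb_nonneg (hσ : G.IsMixed σ) {x z : List M} (hz : z ∈ G.nodes) :
    0 ≤ G.continuationProb σ x z := by
  induction z with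
  | nil => rw [continuationProb]; split_ifs <;> simp
  | cons m z ih =>
    rw [continuationProb]
    split_ifs
    · exact zero_le_one
    · exact mul_nonneg (ih (G.mem_of_cons_mem _ _ hz)) (stepProb_nonneg hσ hz)

theorem reachProb_mul_continuationProb (hσ : G.IsMixed σ) {x z : List M} (h : x <:+ z) :
    G.reachProb σ G.chance x * G.continuationProb σ x z = G.reachProb σ G.chance z := by
  induction z with
  | nil => rw [List.suffix_nil.1 h, continuationProb_self, mul_one]
  | cons m z ih =>
    rcases List.suffix_cons_iff.1 h with rfl | h
    · rw [continuationProb_self, mul_one]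
    · rw [continuationProb_cons h, ← mul_assoc, ih h, reachProb_cons hσ]

theorem sum_continuationProb (hσ : G.IsMixed σ) {x : List M} (hx : x ∈ G.nodes) :
    ∑ z ∈ G.terminalAfter x, G.continuationProb σ x z = 1 := by
  rw [← G.flow_eq_sum_terminalAfter _ hx, continuationProb_self]
  intro y hxy hy
  simp only [continuationProb_cons hxy]
  rw [← Finset.mul_sum, sum_stepProb hσ hy, mul_one]

theorem reachProb_eq_sum (hσ : G.IsMixed σ) {x : List M} (hx : x ∈ G.nodes) :
    G.reachProb σ G.chance x = ∑ z ∈ G.terminalAfter x, G.reachProb σ G.chance z := by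
  refine G.flow_eq_sum_terminalAfter _ hx fun y _ hy => ?_
  simp only [reachProb_cons hσ]
  rw [← Finset.mul_sum, sum_stepProb hσ hy, mul_one]

theorem continuationPayoff_eq (σ : G.StrategyProfile) (i : Player) (x : List M) :
    G.continuationPayoff σ i x =
      ∑ z ∈ G.terminalAfter x, G.continuationProb σ x z * G.payoff i z := by
  classical
  rw [continuationPayoff, terminalAfter, Finset.sum_filter]
  refine Finset.sum_congr rfl fun z _ => ?_
  split_ifs with h
  · rfl
  · rw [continuationProb_of_not_suffix h, zero_mul]

theorem reachProb_mul_continuationPayoff (hσ : G.IsMixed σ) (i : Player) (x : List M) :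
    G.reachProb σ G.chance x * G.continuationPayoff σ i x =
      ∑ z ∈ G.terminalAfter x, G.reachProb σ G.chance z * G.payoff i z := by
  rw [continuationPayoff_eq, Finset.mul_sum]
  refine Finset.sum_congr rfl fun z hz => ?_
  rw [← mul_assoc, reachProb_mul_continuationProb hσ (G.mem_terminalAfter.1 hz).2]

theorem le_continuationPayoff (hσ : G.IsMixed σ) (i : Player) {x : List M} (hx : x ∈ G.nodes)
    {v : ℝ} (hv : ∀ z ∈ G.terminal, x <:+ z → v ≤ G.payoff i z) :
    v ≤ G.continuationPayoff σ i x := by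
  rw [continuationPayoff_eq]
  calc v = ∑ z ∈ G.terminalAfter x, G.continuationProb σ x z * v := by
        rw [← Finset.sum_mul, sum_continuationProb hσ hx, one_mul]
    _ ≤ _ := by
        refine Finset.sum_le_sum fun z hz => ?_
        obtain ⟨hz, hxz⟩ := G.mem_terminalAfter.1 hz
        exact mul_le_mul_of_nonneg_left (hv z hz hxz)
          (continuationProb_nonneg hσ (G.mem_terminal.1 hz).1)

/-- If play from `x` surely ends at `z`, the continuation payoff is the payoff at `z`. -/
theorem continuationPayoff_eq_of_prob_one (hσ : G.IsMixed σ) (i : Player) {x z : List M}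
    (hz : z ∈ G.terminal) (hxz : x <:+ z) (h : G.continuationProb σ x z = 1) :
    G.continuationPayoff σ i x = G.payoff i z := by
  classical
  have hzN := (G.mem_terminal.1 hz).1
  have hzx : z ∈ G.terminalAfter x := G.mem_terminalAfter.2 ⟨hz, hxz⟩
  have hs := sum_continuationProb hσ (G.mem_nodes_of_suffix hzN hxz)
  rw [← Finset.add_sum_erase _ _ hzx, h, add_eq_left, Finset.sum_eq_zero_iff_of_nonneg] at hs
  · rw [continuationPayoff_eq, Finset.sum_eq_single z, h, one_mul]
    · intro w hw hne
      rw [hs w (Finset.mem_erase.2 ⟨hne, hw⟩), zero_mul]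
    · exact fun h => absurd hzx h
  · intro w hw
    exact continuationProb_nonneg hσ
      (G.mem_terminal.1 (G.mem_terminalAfter.1 (Finset.mem_of_mem_erase hw)).1).1

/-! ### Limits of Bayesian beliefs -/

theorem tendsto_reachProb {σn : ℕ → G.StrategyProfile} {χn : ℕ → List M → M → ℝ}
    {χ : List M → M → ℝ}
    (hσn : ∀ j s, Tendsto (fun n => σn n j s) atTop (𝓝 (σ j s)))
    (hχn : ∀ x ∈ G.decisionNodes none, ∀ m ∈ G.moves x,
      Tendsto (fun n => χn n x m) atTop (𝓝 (χ x m))) {x : List M} (hx : x ∈ G.nodes) :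
    Tendsto (fun n => G.reachProb (σn n) (χn n) x) atTop (𝓝 (G.reachProb σ χ x)) := by
  refine Tendsto.mul ?_ (tendsto_finsetProd _ fun i _ => tendsto_finsetSum _ fun s _ => ?_)
  · induction x with
    | nil => exact tendsto_const_nhds
    | cons m x ih =>
      refine (ih (G.mem_of_cons_mem _ _ hx)).mul ?_
      split_ifs with h
      · have hm := G.mem_moves.2 hx
        exact hχn x (G.mem_decisionNodes.2 ⟨⟨m, hm⟩, h⟩) m hm
      · exact tendsto_const_nhds
  · split_ifs
    · exact hσn i s
    · exact tendsto_const_nhds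

theorem mem_nodes_of_mem_cell {i : Player} {h : L} {x : List M} (hx : x ∈ G.cell i h) :
    x ∈ G.nodes := by
  obtain ⟨m, hm⟩ := (G.mem_decisionNodes.1 (G.mem_cell.1 hx).1).1
  exact G.mem_of_cons_mem _ _ (G.mem_moves.1 hm)

/-- Weakly consistent beliefs satisfy Bayes' rule. -/
theorem belief_mul_sum_reachProb {ψ : Player → L → List M → ℝ} (hψ : G.WeaklyConsistent ψ σ)
    {i : Player} {h : L} (hh : h ∈ G.infoSets i) {x : List M} (hx : x ∈ G.cell i h) :
    ψ i h x * ∑ y ∈ G.cell i h, G.reachProb σ G.chance y = G.reachProb σ G.chance x := by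
  obtain ⟨σn, χn, hσ, hχ, hσn, hχn, hb⟩ := hψ i
  refine tendsto_nhds_unique ((hb h hh x hx).mul (tendsto_finsetSum _ fun y hy =>
    tendsto_reachProb hσn hχn (mem_nodes_of_mem_cell hy)))
    ((tendsto_reachProb hσn hχn (mem_nodes_of_mem_cell hx)).congr fun n => ?_)
  have hnn : ∀ y ∈ G.cell i h, 0 ≤ G.reachProb (σn n) (χn n) y := fun y hy => by
    refine reachProb_nonneg (hσ n).1 (fun w m hw hwm => ?_) (mem_nodes_of_mem_cell hy)
    have hm := G.mem_moves.2 hw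
    exact ((hχ n w (G.mem_decisionNodes.2 ⟨⟨m, hm⟩, hwm⟩)).1 m hm).le
  -- If the denominator vanished, all nodes of the cell would be null and both sides zero.
  by_cases h0 : ∑ y ∈ G.cell i h, G.reachProb (σn n) (χn n) y = 0
  · rw [h0, mul_zero]
    exact (Finset.sum_eq_zero_iff_of_nonneg hnn).1 h0 x hx
  · rw [bayesBelief, div_mul_cancel₀ _ h0]

/-- Bayesian beliefs converge if the probabilities of the nodes, suitably scaled, converge to
weights that do not all vanish. -/
theorem tendsto_bayesBelief {σn : ℕ → G.StrategyProfile} {χn : ℕ → List M → M → ℝ}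
    {i : Player} {h : L} {ε : ℕ → ℝ} (hε : ∀ n, ε n ≠ 0) {l : List M → ℝ}
    (hl : ∀ x ∈ G.cell i h,
      Tendsto (fun n => G.reachProb (σn n) (χn n) x / ε n) atTop (𝓝 (l x)))
    (h0 : ∑ x ∈ G.cell i h, l x ≠ 0) {x : List M} (hx : x ∈ G.cell i h) :
    Tendsto (fun n => G.bayesBelief (σn n) (χn n) i h x) atTop
      (𝓝 (l x / ∑ y ∈ G.cell i h, l y)) := by
  refine ((hl x hx).div (tendsto_finsetSum _ hl) h0).congr fun n => ?_
  rw [Pi.div_apply, ← Finset.sum_div, bayesBelief, div_div_div_cancel_right₀ (hε n)]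

end Prob

end ExtensiveGame

/-! ### Action profiles and the mediated game -/

section Profiles

variable {A : Player → Type u}

theorem joinProfile_self (i : Player) (x : A i) (b : A (!i)) : joinProfile i x b i = x := by
  cases i <;> rfl

theorem joinProfile_eta (i : Player) (a : ∀ j, A j) : joinProfile i (a i) (a (!i)) = a := by
  funext j
  cases i <;> cases j <;> rfl

theorem eq_or_eq_not (i j : Player) : i = j ∨ i = !j := by
  cases i <;> cases j <;> simp

-- With a single deviator `j`, the mediator's reaction matters only if `j` moves first and really
-- deviates. If `j` moves second, his opponent has already obeyed.
open Classical in
theorem mediatedOutcome_update (p : ∀ i : Player, A i → A (!i)) (j : Player) (d : A j → A j)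
    (a : ∀ j, A j) (i : Player) :
    mediatedOutcome p (Function.update (fun _ => id) j d) a i =
      if i = j then (if d (a j) = a j then a else joinProfile j (d (a j)) (p j (d (a j))))
      else joinProfile j (d (a j)) (a (!j)) := by
  have h : ∀ j, (!j) ≠ j := by simp
  rcases eq_or_eq_not i j with rfl | rfl
  · simp only [mediatedOutcome, Function.update_self, Function.update_of_ne (h i), id, if_true]
    split_ifs with hd
    · rw [hd, joinProfile_eta]
    · rfl
  · rw [if_neg (h j)]
    have hj : Function.update (fun j => (id : A j → A j)) j d (!j) (a (!j)) = a (!j) := by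
      rw [Function.update_of_ne (h j), id]
    rw [mediatedOutcome, if_pos hj,
      joinProfile_eta (!j) (fun k => Function.update (fun j => (id : A j → A j)) j d k (a k)),
      ← joinProfile_eta j (fun k => Function.update (fun j => (id : A j → A j)) j d k (a k)),
      hj, Function.update_self]

theorem mediatedOutcome_update_of_eq (p : ∀ i : Player, A i → A (!i)) {j : Player}
    {d : A j → A j} {a : ∀ j, A j} (h : d (a j) = a j) (i : Player) :
    mediatedOutcome p (Function.update (fun _ => id) j d) a i = a := by
  rw [mediatedOutcome_update, h, joinProfile_eta]
  simp

theorem mediatedOutcome_id (p : ∀ i : Player, A i → A (!i)) (a : ∀ j, A j) (i : Player) :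
    mediatedOutcome p (fun _ => id) a i = a := by
  simp [mediatedOutcome, joinProfile_eta]

end Profiles

/-! ### Necessity: what equilibrium in an arbitrary mechanism implies. -/

namespace ExtensiveGame

variable {M L : Type u} {G : ExtensiveGame M L}

/-! ### Incentives in quasi-sequential equilibria -/

/-- The reach probability of `m :: x` is the belief at `x` times the probability of the cell times
that of `m`, and the last two factors are common to the cell. The sum is therefore a nonnegative
multiple of the interim gain of `m` over `m'`, or zero if `m` is never reached. -/
theorem sum_cell_gain_nonneg {ψ : Player → L → List M → ℝ} {σ : G.StrategyProfile}
    (hQ : G.IsQSE ψ σ) {i : Player} {h : L} (hh : h ∈ G.infoSets i) {m m' : M}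
    (hm : m ∈ G.infoMoves i h) (hm' : m' ∈ G.infoMoves i h) :
    0 ≤ ∑ x ∈ G.cell i h, G.reachProb σ G.chance (m :: x) *
      (G.continuationPayoff σ i (m :: x) - G.continuationPayoff σ i (m' :: x)) := by
  obtain ⟨-, hσ, hψ, hrat⟩ := hQ
  have hR : ∀ x ∈ G.cell i h, ∀ n ∈ G.infoMoves i h, 0 ≤ G.reachProb σ G.chance (n :: x) :=
    fun x hx n hn => reachProb_nonneg hσ G.chance_nonneg
      (G.mem_moves.1 ((G.mem_infoMoves hx).1 hn))
  by_cases hpos : ∃ x ∈ G.cell i h, 0 < G.reachProb σ G.chance (m :: x)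
  · obtain ⟨x₀, hx₀, hp⟩ := hpos
    set S := ∑ y ∈ G.cell i h, G.reachProb σ G.chance y with hS
    have hSnn : 0 ≤ S := Finset.sum_nonneg fun y hy =>
      reachProb_nonneg hσ G.chance_nonneg (mem_nodes_of_mem_cell hy)
    have hqnn : 0 ≤ G.stepProb σ x₀ m :=
      stepProb_nonneg hσ (G.mem_moves.1 ((G.mem_infoMoves hx₀).1 hm))
    have hopt : G.interimPayoff ψ σ i h m' ≤ G.interimPayoff ψ σ i h m := by
      have hd := (G.mem_cell.1 hx₀).1
      -- A reached move is prescribed by some pure strategy in the support, to which sequential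
      -- rationality applies.
      have hPpos : 0 < strategyProb (σ i) (fun s => AllowsNode s (m :: x₀)) := by
        refine lt_of_le_of_ne (strategyProb_nonneg (hσ i).1 _) fun h0 => hp.ne' ?_
        rw [reachProb, prod_player i, ← h0]
        ring
      obtain ⟨s, hs, hs0⟩ := exists_pos_of_strategyProb_pos hPpos
      have := hs.2 (G.mem_decisionNodes.1 hd).2 ⟨h, hh⟩ (G.mem_cell.1 hx₀).2.symm
      have hr := hrat i ⟨h, hh⟩ s hs0 m' hm'
      rwa [this] at hr
    have : ∑ x ∈ G.cell i h, G.reachProb σ G.chance (m :: x) *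
        (G.continuationPayoff σ i (m :: x) - G.continuationPayoff σ i (m' :: x)) =
        S * G.stepProb σ x₀ m * (G.interimPayoff ψ σ i h m - G.interimPayoff ψ σ i h m') := by
      rw [interimPayoff, interimPayoff, ← Finset.sum_sub_distrib, Finset.mul_sum]
      refine Finset.sum_congr rfl fun x hx => ?_
      rw [reachProb_cons hσ, ← belief_mul_sum_reachProb hψ hh hx, stepProb_congr i hx hx₀]
      ring
    rw [this]
    exact mul_nonneg (mul_nonneg hSnn hqnn) (sub_nonneg.2 hopt)
  · push Not at hpos
    refine Finset.sum_nonneg fun x hx => ?_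
    rw [le_antisymm (hpos x hx) (hR x hx m hm), zero_mul]

/-! ### Pivotal moves in mechanisms -/

variable {A : Player → Type u} {u : Player → (∀ j, A j) → ℝ} {τ : List M → (∀ j, A j)}

/-- After `m` the action is fixed at `a`, whereas representing `a` again would require a
continuation with another action. -/
theorem Represents.not_suffix {i : Player} {x x' : List M} {m m' : M} {a : A i}
    (h : G.Represents τ i x m a) (h' : G.Represents τ i x' m' a) : ¬ (m :: x) <:+ x' := by
  intro hs
  obtain ⟨n, -, z, hz, hnz, hne⟩ := h'.2.2
  exact hne (h.2.1 z hz ((hs.trans (List.suffix_cons n x')).trans hnz))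

theorem Represents.unique {i : Player} {x x' z : List M} {m m' : M} {a : A i}
    (h : G.Represents τ i x m a) (h' : G.Represents τ i x' m' a) (hz : (m :: x) <:+ z)
    (hz' : (m' :: x') <:+ z) : x = x' ∧ m = m' := by
  rcases List.suffix_or_suffix_of_suffix hz hz' with hs | hs
  · rcases List.suffix_cons_iff.1 hs with he | hs
    · exact ⟨(List.cons.inj he).2, (List.cons.inj he).1⟩
    · exact absurd hs (h.not_suffix h')
  · rcases List.suffix_cons_iff.1 hs with he | hs
    · exact ⟨(List.cons.inj he).2.symm, (List.cons.inj he).1.symm⟩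
    · exact absurd hs (h'.not_suffix h)

theorem IsPivotal.of_mem_cell (hd : G.FullDisclosure τ) {i : Player} {h : L} {x y : List M}
    (hh : h ∈ G.infoSets i) (hx : x ∈ G.cell i h) (hy : y ∈ G.cell i h)
    (hp : G.IsPivotal τ i x) : G.IsPivotal τ i y :=
  ⟨(G.mem_cell.1 hy).1, fun a => (hp.2 a).imp fun m hm => (hd i h hh x hx y hy m a).1 hm⟩

open Classical in
/-- If `D` is a lower bound for what player `i` obtains by representing `a'` instead of `a`, then
he does not gain from this deviation. -/
theorem sum_terminal_gain_nonneg (hG : G.IsMechanism u τ) {ψ : Player → L → List M → ℝ}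
    {σ : G.StrategyProfile} (hQ : G.IsQSE ψ σ) (i : Player) (a a' : A i) (D : List M → ℝ)
    (hD : ∀ x m m' z, G.IsPivotal τ i x → G.Represents τ i x m a → G.Represents τ i x m' a' →
      z ∈ G.terminal → (m :: x) <:+ z → D z ≤ G.continuationPayoff σ i (m' :: x)) :
    0 ≤ ∑ z ∈ G.terminal.filter (fun z => τ z i = a),
      G.reachProb σ G.chance z * (u i (τ z) - D z) := by
  obtain ⟨⟨-, hpay⟩, hd, hpiv⟩ := hG
  have hσ := hQ.2.1
  let P : List M → M → Prop := fun x m => G.IsPivotal τ i x ∧ G.Represents τ i x m a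
  let f : List M → ℝ := fun z => G.reachProb σ G.chance z * (u i (τ z) - D z)
  let T : Finset (Σ _ : List M, M) :=
    ((G.decisionNodes (some i)).sigma fun x => G.infoMoves i (G.label x)).filter
      fun q => P q.1 q.2
  have hmT : ∀ x m, (⟨x, m⟩ : Σ _ : List M, M) ∈ T ↔ P x m := by
    intro x m
    simp only [T, Finset.mem_filter, Finset.mem_sigma, and_iff_right_iff_imp]
    intro hP
    exact ⟨hP.1.1, (G.mem_infoMoves (G.mem_cell.2 ⟨hP.1.1, rfl⟩)).2 hP.2.1⟩
  -- The pivotal moves that represent `a` cut these terminal nodes into disjoint groups: each path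
  -- contains such a move, and by `Represents.unique` only one.
  have hfilter : G.terminal.filter (fun z => τ z i = a) =
      T.biUnion fun q => G.terminalAfter (q.2 :: q.1) := by
    ext z
    simp only [Finset.mem_filter, Finset.mem_biUnion, mem_terminalAfter]
    constructor
    · rintro ⟨hz, rfl⟩
      obtain ⟨x, m, hx, hm, hs⟩ := hpiv z hz i
      exact ⟨⟨x, m⟩, (hmT x m).2 ⟨hx, hm⟩, hz, hs⟩
    · rintro ⟨⟨x, m⟩, hq, hz, hs⟩
      exact ⟨hz, ((hmT x m).1 hq).2.2.1 z hz hs⟩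
  have hsum : ∑ z ∈ G.terminal.filter (fun z => τ z i = a), f z =
      ∑ h ∈ G.infoSets i, ∑ x ∈ G.cell i h, ∑ m ∈ G.infoMoves i h,
        if P x m then ∑ z ∈ G.terminalAfter (m :: x), f z else 0 := by
    rw [hfilter, Finset.sum_biUnion]
    · rw [Finset.sum_filter, Finset.sum_sigma, ← Finset.sum_fiberwise_of_maps_to
        (s := G.decisionNodes (some i)) (t := G.infoSets i) (g := G.label)
        fun x hx => label_mem_infoSets hx]
      refine Finset.sum_congr rfl fun h _ => Finset.sum_congr rfl fun x hx => ?_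
      rw [(Finset.mem_filter.1 hx).2]
    · rintro ⟨x, m⟩ hq ⟨x', m'⟩ hq' hne
      refine Finset.disjoint_left.2 fun z hz hz' => hne ?_
      obtain ⟨rfl, rfl⟩ := ((hmT x m).1 hq).2.unique ((hmT x' m').1 hq').2
        (G.mem_terminalAfter.1 hz).2 (G.mem_terminalAfter.1 hz').2
      rfl
  change 0 ≤ ∑ z ∈ G.terminal.filter (fun z => τ z i = a), f z
  rw [hsum]
  refine Finset.sum_nonneg fun h hh => ?_
  -- Full disclosure makes pivotality a property of the information set, and lets one move `m'`
  -- represent `a'` at all of its nodes.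
  by_cases hp : ∃ x ∈ G.cell i h, G.IsPivotal τ i x
  · obtain ⟨x₀, hx₀, hp₀⟩ := hp
    obtain ⟨m', hm'⟩ := hp₀.2 a'
    have hm'mem := (G.mem_infoMoves hx₀).2 hm'.1
    rw [Finset.sum_comm]
    refine Finset.sum_nonneg fun m hm => ?_
    by_cases hPm : P x₀ m
    · refine (sum_cell_gain_nonneg hQ hh hm hm'mem).trans (Finset.sum_le_sum fun x hx => ?_)
      have hPx : P x m := ⟨hPm.1.of_mem_cell hd hh hx₀ hx, (hd i h hh x₀ hx₀ x hx m a).1 hPm.2⟩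
      have hrep' : G.Represents τ i x m' a' := (hd i h hh x₀ hx₀ x hx m' a').1 hm'
      rw [if_pos hPx, mul_sub, reachProb_mul_continuationPayoff hσ,
        reachProb_eq_sum hσ (G.mem_moves.1 hPx.2.1), Finset.sum_mul, ← Finset.sum_sub_distrib]
      refine Finset.sum_le_sum fun z hz => ?_
      obtain ⟨hz, hs⟩ := G.mem_terminalAfter.1 hz
      rw [hpay z hz i, ← mul_sub]
      exact mul_le_mul_of_nonneg_left
        (sub_le_sub_left (hD x m m' z hPx.1 hPx.2 hrep' hz hs) _)
        (reachProb_nonneg hσ G.chance_nonneg (G.mem_terminal.1 hz).1)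
    · refine Finset.sum_nonneg fun x hx => ?_
      rw [if_neg]
      exact fun hPx => hPm
        ⟨hPx.1.of_mem_cell hd hh hx hx₀, (hd i h hh x hx x₀ hx₀ m a).1 hPx.2⟩
  · push Not at hp
    refine Finset.sum_nonneg fun x hx => Finset.sum_nonneg fun m _ => ?_
    rw [if_neg fun hP : P x m => hp x hx hP.1]

variable (G τ) in
/-- On the way to `z`, player `i` makes his pivotal move before his opponent. -/
def MovesFirst (i : Player) (z : List M) : Prop :=
  ∃ x m y n, G.IsPivotal τ i x ∧ G.Represents τ i x m (τ z i) ∧ G.IsPivotal τ (!i) y ∧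
    G.Represents τ (!i) y n (τ z (!i)) ∧ (m :: x) <:+ y ∧ (n :: y) <:+ z

/-- Both pivotal moves lie on the path to `z`, hence are comparable, and they occur at different
nodes since a node has one mover. -/
theorem movesFirst_or (hG : G.IsMechanism u τ) {z : List M} (hz : z ∈ G.terminal) (i : Player) :
    MovesFirst G τ i z ∨ MovesFirst G τ (!i) z := by
  obtain ⟨x, m, hx, hm, hs⟩ := hG.2.2 z hz i
  obtain ⟨y, n, hy, hn, hs'⟩ := hG.2.2 z hz (!i)
  have hne : x ≠ y := by
    rintro rfl
    have h1 := (G.mem_decisionNodes.1 hx.1).2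
    rw [(G.mem_decisionNodes.1 hy.1).2] at h1
    simp at h1
  rcases List.suffix_or_suffix_of_suffix hs hs' with h | h
  · rcases List.suffix_cons_iff.1 h with he | h
    · exact absurd (List.cons.inj he).2 hne
    · exact Or.inl ⟨x, m, y, n, hx, hm, hy, hn, h, hs'⟩
  · rcases List.suffix_cons_iff.1 h with he | h
    · exact absurd (List.cons.inj he).2.symm hne
    · refine Or.inr ⟨y, n, x, m, hy, hn, ?_⟩
      rw [Bool.not_not]
      exact ⟨hx, hm, h, hs⟩

end ExtensiveGame

open ExtensiveGame in
/-- Quasi-sequentially implementable distributions are interdependent-choice equilibria. -/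
theorem IsQSImplementable.isICE {A : Player → Type u} [∀ i, Fintype (A i)] [∀ i, Nonempty (A i)]
    {u : Player → (∀ j, A j) → ℝ} {α : (∀ j, A j) → ℝ} (hα : α ∈ stdSimplex ℝ (∀ j, A j))
    (h : IsQSImplementable u α) : IsICE u α := by
  classical
  obtain ⟨M, L, G, τ, hG, ψ, σ, hQ, hατ⟩ := h
  have hσ := hQ.2.1
  set R := G.reachProb σ G.chance with hR
  have hRnn : ∀ z ∈ G.terminal, 0 ≤ R z := fun z hz =>
    reachProb_nonneg hσ G.chance_nonneg (G.mem_terminal.1 hz).1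
  have hworst : ∀ (i : Player) (x : A i), ∃ b : A (!i), ∀ c,
      u i (joinProfile i x b) ≤ u i (joinProfile i x c) := fun i x =>
    Finite.exists_min fun b => u i (joinProfile i x b)
  choose p hp using hworst
  let first : List M → Player := fun z => decide (MovesFirst G τ true z)
  have hfirst : ∀ z ∈ G.terminal, MovesFirst G τ (first z) z := by
    intro z hz
    by_cases h : MovesFirst G τ true z
    · simp only [first, h, decide_true]
    · simp only [first, h, decide_false]
      exact (movesFirst_or hG hz true).resolve_left h
  -- The joint law of the outcome and of the player who settles first; `θ` is its conditional law,
  -- with an arbitrary value outside the support of `α`.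
  let ρ : (∀ j, A j) → Player → ℝ := fun a k =>
    ∑ z ∈ G.terminal, if τ z = a ∧ first z = k then R z else 0
  have hρnn : ∀ a k, 0 ≤ ρ a k := fun a k => Finset.sum_nonneg fun z hz => by
    split_ifs
    exacts [hRnn z hz, le_rfl]
  have hρα : ∀ a, ∑ k, ρ a k = α a := by
    intro a
    rw [hατ a, Finset.sum_comm]
    refine Finset.sum_congr rfl fun z _ => ?_
    by_cases hz : τ z = a <;> simp [hz]
  let θ : (∀ j, A j) → Player → ℝ := fun a k =>
    if α a = 0 then (if k = true then 1 else 0) else ρ a k / α a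
  have hαθ : ∀ a k, α a * θ a k = ρ a k := by
    intro a k
    by_cases h0 : α a = 0
    · rw [h0, zero_mul, eq_comm]
      rw [← hρα a] at h0
      exact (Finset.sum_eq_zero_iff_of_nonneg fun k _ => hρnn a k).1 h0 k (Finset.mem_univ k)
    · simp only [θ, h0, if_false]
      field_simp
  -- Expectations over the mediator's draws become expectations over terminal nodes of the
  -- mechanism.
  have hsum : ∀ F : (∀ j, A j) → Player → ℝ,
      ∑ a, ∑ k, α a * θ a k * F a k = ∑ z ∈ G.terminal, R z * F (τ z) (first z) := by
    intro F
    simp only [hαθ, ρ, Finset.sum_mul]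
    simp_rw [Finset.sum_comm (t := G.terminal)]
    refine Finset.sum_congr rfl fun z _ => ?_
    rw [Finset.sum_eq_single (τ z), Finset.sum_eq_single (first z)]
    · simp
    · intro k _ hk
      simp [hk.symm]
    · simp
    · intro a _ ha
      simp [ha.symm]
    · simp
  refine ⟨hα, θ, p, fun a => ⟨fun k => ?_, ?_⟩, fun i x => ⟨Or.inl trivial, fun b _ => hp i x b⟩,
    fun j d => ?_⟩
  · simp only [θ]
    split_ifs
    · exact zero_le_one
    · exact le_rfl
    · exact div_nonneg (hρnn a k) (hα.1 a)
  · by_cases h0 : α a = 0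
    · simp [θ, h0]
    · simp only [θ, h0, if_false]
      rw [← Finset.sum_div, hρα, div_self h0]
  -- Grouping terminal nodes by the action `a` of `j` splits the deviation `d` into separate
  -- replacements of `a` by `d a`.
  · rw [← sub_nonneg, mediatedPayoff, mediatedPayoff,
      hsum fun a k => u j (mediatedOutcome p (fun _ => id) a k),
      hsum fun a k => u j (mediatedOutcome p (Function.update (fun _ => id) j d) a k),
      ← Finset.sum_sub_distrib,
      ← Finset.sum_fiberwise G.terminal (fun z => τ z j)]
    refine Finset.sum_nonneg fun a _ => ?_
    simp only [mediatedOutcome_id, mediatedOutcome_update, ← mul_sub]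
    by_cases hda : d a = a
    · refine (Finset.sum_eq_zero fun z hz => ?_).ge
      obtain ⟨hz, rfl⟩ := Finset.mem_filter.1 hz
      simp [hda, joinProfile_eta]
    · refine (sum_terminal_gain_nonneg hG hQ j a (d a) (fun z => u j (if first z = j then
        joinProfile j (d a) (p j (d a)) else joinProfile j (d a) (τ z (!j)))) ?_).trans_eq ?_
      · intro x m m' z hx hm hm' hz hs
        have hτj : τ z j = a := hm.2.1 z hz hs
        refine le_continuationPayoff hσ j (G.mem_moves.1 hm'.1) fun w hw hxw => ?_
        have hwj : τ w j = d a := hm'.2.1 w hw hxw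
        rw [hG.1.2 w hw, ← joinProfile_eta j (τ w), hwj]
        split_ifs with hf
        · exact hp j (d a) _
        -- Here the opponent settles first. By uniqueness his pivotal move precedes the very node
        -- `x` at which `j` deviates, so his action survives the deviation.
        · have hlead := hfirst z hz
          rw [(eq_or_eq_not (first z) j).resolve_left hf] at hlead
          obtain ⟨y, n, x', n', -, hn, -, hn', hyx, hxz⟩ := hlead
          rw [Bool.not_not, hτj] at hn'
          obtain ⟨rfl, -⟩ := hm.unique hn' hs hxz
          rw [hn.2.1 w hw ((hyx.trans (List.suffix_cons m' x)).trans hxw)]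
      · refine Finset.sum_congr rfl fun z hz => ?_
        obtain ⟨hz, rfl⟩ := Finset.mem_filter.1 hz
        simp only [hda, if_false, hR]

/-! ### Sufficiency: construction of the mechanism. -/

/-! ### The mediated game in extensive form

Nature draws the first mover and the intended profile. Then the players move one after the other,
each at the information set given by his recommendation. -/

namespace MediatedGame

variable {A : Player → Type u}

/-- The moves: draws of Nature and actions of the players. -/
abbrev Move (A : Player → Type u) : Type u := (Player × (∀ j, A j)) ⊕ (Σ j, A j)

/-- Every draw is available, even those of probability zero, and so is every action. The entries
read backwards: second action, first action, draw. -/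
def IsNode : List (Move A) → Prop
  | [] => True
  | [.inl _] => True
  | [.inr q, .inl k] => q.1 = k.1
  | [.inr q', .inr q, .inl k] => q.1 = k.1 ∧ q'.1 = !k.1
  | _ => False

def mover : List (Move A) → Option Player
  | [.inl k] => some k.1
  | [_, .inl k] => some (!k.1)
  | _ => none

open Classical in
/-- The recommendation that the player who moves at a node has received. -/
noncomputable def recommendation [∀ i, Nonempty (A i)] (p : ∀ i : Player, A i → A (!i)) :
    List (Move A) → Σ j, A j
  | [.inl k] => ⟨k.1, k.2 k.1⟩
  | [.inr q, .inl k] => if q = ⟨k.1, k.2 k.1⟩ then ⟨!k.1, k.2 (!k.1)⟩ else ⟨!q.1, p q.1 q.2⟩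
  | _ => ⟨true, Classical.arbitrary _⟩

/-- The action profile at a terminal node. -/
noncomputable def outcome [∀ i, Nonempty (A i)] : List (Move A) → ∀ j, A j
  | [.inr q', .inr q, .inl k] => Function.update (Function.update k.2 q.1 q.2) q'.1 q'.2
  | _ => fun _ => Classical.arbitrary _

/-- The probabilities of the draws of Nature. -/
def drawProb (w : Player × (∀ j, A j) → ℝ) : List (Move A) → Move A → ℝ :=
  fun _ m => m.elim w 0

theorem isNode_of_cons {x : List (Move A)} {m : Move A} (h : IsNode (m :: x)) : IsNode x := by
  rcases x with _ | ⟨m₁, _ | ⟨m₂, _ | ⟨m₃, x⟩⟩⟩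
  · trivial
  · rcases m with k | q <;> rcases m₁ with k₁ | q₁ <;> simp_all [IsNode]
  · rcases m with k | q <;> rcases m₁ with k₁ | q₁ <;> rcases m₂ with k₂ | q₂ <;> simp_all [IsNode]
  · simp [IsNode] at h

theorem isNode_length {x : List (Move A)} (h : IsNode x) : x.length ≤ 3 := by
  rcases x with _ | ⟨m₁, _ | ⟨m₂, _ | ⟨m₃, _ | ⟨m₄, x⟩⟩⟩⟩ <;> simp_all [IsNode]

/-- The shape of the decision nodes of player `i`. -/
theorem isNode_cons_mover {x : List (Move A)} {m : Move A} {i : Player} (h : IsNode (m :: x))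
    (hx : mover x = some i) : (∃ a, x = [.inl (i, a)]) ∨
      ∃ q : Σ j, A j, ∃ a, q.1 = !i ∧ x = [.inr q, .inl (!i, a)] := by
  rcases x with _ | ⟨m₁, _ | ⟨m₂, _ | ⟨m₃, x⟩⟩⟩
  · simp [mover] at hx
  · rcases m₁ with ⟨k, a⟩ | q <;> simp_all [mover]
  · rcases m₂ with ⟨k, a⟩ | q₂
    · simp only [mover, Option.some.injEq] at hx
      subst hx
      rcases m with m | q <;> rcases m₁ with m₁ | q₁ <;> simp_all [IsNode]
    · simp [mover] at hx
  · simp [IsNode] at h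

theorem isNode_cons_iff {x : List (Move A)} {i : Player}
    (hx : (∃ a, x = [.inl (i, a)]) ∨ ∃ q : Σ j, A j, ∃ a, q.1 = !i ∧ x = [.inr q, .inl (!i, a)])
    (m : Move A) : IsNode (m :: x) ↔ ∃ y, m = .inr ⟨i, y⟩ := by
  rcases hx with ⟨a, rfl⟩ | ⟨q, a, hq, rfl⟩
  · rcases m with m | ⟨j, y⟩
    · simp [IsNode]
    · simp only [IsNode, Sum.inr.injEq]
      exact ⟨by rintro rfl; exact ⟨y, rfl⟩, by rintro ⟨y, h⟩; exact congrArg Sigma.fst h⟩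
  · rcases m with m | ⟨j, y⟩
    · simp [IsNode]
    · simp only [IsNode, Sum.inr.injEq, hq, true_and, Bool.not_not]
      exact ⟨by rintro rfl; exact ⟨y, rfl⟩, by rintro ⟨y, h⟩; exact congrArg Sigma.fst h⟩

variable [∀ i, Fintype (A i)] [∀ i, Nonempty (A i)]

/-- The mediated game as an extensive form game: Nature draws the first mover and the intended
profile according to `w`, and deviations of the first mover are answered according to `p`. -/
noncomputable def game (u : Player → (∀ j, A j) → ℝ) (p : ∀ i : Player, A i → A (!i))
    (w : Player × (∀ j, A j) → ℝ) (hw : w ∈ stdSimplex ℝ (Player × (∀ j, A j))) :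
    ExtensiveGame (Move A) (Σ j, A j) where
  nodes := ((List.finite_length_le (Move A) 3).subset fun _ h => isNode_length h :
    {x : List (Move A) | IsNode x}.Finite).toFinset
  root_mem := by simp [IsNode]
  mem_of_cons_mem x m h := by
    rw [Set.Finite.mem_toFinset] at *
    exact isNode_of_cons h
  mover := mover
  label := recommendation p
  chance := drawProb w
  payoff i z := u i (outcome z)
  same_moves i x y m m' hx hy hxi hyi _ m'' := by
    simp only [Set.Finite.mem_toFinset, Set.mem_ofPred_eq] at *
    rw [isNode_cons_iff (isNode_cons_mover hx hxi), isNode_cons_iff (isNode_cons_mover hy hyi)]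
  perfect_recall i x y m m' hx hy hxi hyi _ := by
    -- Each player moves only once on a path, so his record is empty whenever he moves.
    have key : ∀ (x : List (Move A)) (m : Move A), IsNode (m :: x) → mover x = some i →
        experienceOf mover (recommendation p) i x = [] := by
      intro x m hx hxi
      rcases isNode_cons_mover hx hxi with ⟨a, rfl⟩ | ⟨q, a, -, rfl⟩ <;>
        simp [experienceOf, mover]
    simp only [Set.Finite.mem_toFinset, Set.mem_ofPred_eq] at hx hy
    rw [key x m hx hxi, key y m' hy hyi]
  chance_nonneg x m _ _ := by
    rcases m with k | q
    · exact hw.1 k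
    · exact le_rfl
  chance_sum x m hx hxn := by
    simp only [Set.Finite.mem_toFinset, Set.mem_ofPred_eq] at hx
    obtain rfl : x = [] := by
      rcases x with _ | ⟨m₁, _ | ⟨m₂, _ | ⟨m₃, x⟩⟩⟩
      · rfl
      · rcases m₁ with k₁ | q₁
        · simp [mover] at hxn
        · rcases m with k | q <;> simp [IsNode] at hx
      · rcases m with k | q <;> rcases m₁ with k₁ | q₁ <;> rcases m₂ with k₂ | q₂ <;>
          simp_all [IsNode, mover]
      · simp [IsNode] at hx
    rw [← hw.2]
    symm
    refine Finset.sum_bij_ne_zero (fun k _ _ => .inl k) ?_ ?_ ?_ ?_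
    · intro k _ _
      simp [IsNode]
    · rintro k _ _ k' _ _ h
      exact Sum.inl_injective h
    · rintro (k | q) hm h0
      · exact ⟨k, Finset.mem_univ _, h0, rfl⟩
      · exact absurd rfl h0
    · intro k _ _
      rfl

variable {u : Player → (∀ j, A j) → ℝ} {p : ∀ i : Player, A i → A (!i)}
  {w : Player × (∀ j, A j) → ℝ} {hw : w ∈ stdSimplex ℝ (Player × (∀ j, A j))}

local notation "Γ" => game u p w hw

theorem mem_nodes {x : List (Move A)} : x ∈ (Γ).nodes ↔ IsNode x :=
  Set.Finite.mem_toFinset _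

theorem mem_moves {x : List (Move A)} {m : Move A} : m ∈ (Γ).moves x ↔ IsNode (m :: x) := by
  rw [ExtensiveGame.mem_moves, mem_nodes]

theorem mem_decisionNodes {i : Player} {x : List (Move A)} :
    x ∈ (Γ).decisionNodes (some i) ↔ (∃ a, x = [.inl (i, a)]) ∨
      ∃ q : Σ j, A j, ∃ a, q.1 = !i ∧ x = [.inr q, .inl (!i, a)] := by
  rw [ExtensiveGame.mem_decisionNodes]
  constructor
  · rintro ⟨⟨m, hm⟩, hx⟩
    exact isNode_cons_mover (mem_moves.1 hm) hx
  · intro h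
    refine ⟨⟨.inr ⟨i, Classical.arbitrary _⟩, mem_moves.2 ((isNode_cons_iff h _).2 ⟨_, rfl⟩)⟩, ?_⟩
    rcases h with ⟨a, rfl⟩ | ⟨q, a, -, rfl⟩ <;> simp [game, mover]

theorem mem_moves_of_decision {i : Player} {x : List (Move A)}
    (hx : x ∈ (Γ).decisionNodes (some i)) {m : Move A} :
    m ∈ (Γ).moves x ↔ ∃ y, m = .inr ⟨i, y⟩ := by
  rw [mem_moves, isNode_cons_iff (mem_decisionNodes.1 hx)]

theorem mem_decisionNodes_none {x : List (Move A)} (hx : x ∈ (Γ).decisionNodes none) :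
    x = [] := by
  obtain ⟨⟨m, hm⟩, hxn⟩ := (ExtensiveGame.mem_decisionNodes _).1 hx
  rw [mem_moves] at hm
  change mover x = none at hxn
  rcases x with _ | ⟨m₁, _ | ⟨m₂, _ | ⟨m₃, x⟩⟩⟩
  · rfl
  · rcases m₁ with k₁ | q₁
    · simp [mover] at hxn
    · rcases m with k | q <;> simp [IsNode] at hm
  · rcases m with k | q <;> rcases m₁ with k₁ | q₁ <;> rcases m₂ with k₂ | q₂ <;>
      simp_all [IsNode, mover]
  · simp [IsNode] at hm

theorem recommendation_fst {i : Player} {x : List (Move A)}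
    (hx : x ∈ (Γ).decisionNodes (some i)) : (recommendation p x).1 = i := by
  rcases mem_decisionNodes.1 hx with ⟨a, rfl⟩ | ⟨q, a, hq, rfl⟩
  · rfl
  · simp only [recommendation]
    split_ifs <;> simp [hq]

/-- Any action can be recommended, since Nature can draw `i` as first mover together with any
profile. -/
theorem mem_infoSets {i : Player} {h : Σ j, A j} : h ∈ (Γ).infoSets i ↔ h.1 = i := by
  rw [ExtensiveGame.mem_infoSets]
  constructor
  · rintro ⟨x, hx, rfl⟩
    exact recommendation_fst hx
  · rintro rfl
    refine ⟨[.inl (h.1, Function.update (fun _ => Classical.arbitrary _) h.1 h.2)],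
      mem_decisionNodes.2 (Or.inl ⟨_, rfl⟩), ?_⟩
    simp [game, recommendation]

theorem mem_infoMoves {i : Player} {h : Σ j, A j} (hh : h ∈ (Γ).infoSets i) {m : Move A} :
    m ∈ (Γ).infoMoves i h ↔ ∃ y, m = .inr ⟨i, y⟩ := by
  obtain ⟨x, hx, rfl⟩ := (ExtensiveGame.mem_infoSets _).1 hh
  rw [ExtensiveGame.mem_infoMoves _ ((ExtensiveGame.mem_cell _).2 ⟨hx, rfl⟩),
    mem_moves_of_decision hx]

theorem mem_terminal {z : List (Move A)} : z ∈ (Γ).terminal ↔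
    ∃ (k : Player × (∀ j, A j)) (q q' : Σ j, A j), q.1 = k.1 ∧ q'.1 = (!k.1) ∧
      z = [.inr q', .inr q, .inl k] := by
  rw [ExtensiveGame.mem_terminal, mem_nodes]
  constructor
  · rintro ⟨hz, h0⟩
    have hno : ∀ m, ¬ IsNode (m :: z) := fun m hm => by
      rw [← mem_moves (u := u) (p := p) (w := w) (hw := hw), h0] at hm
      simp at hm
    rcases z with _ | ⟨m₁, _ | ⟨m₂, _ | ⟨m₃, _ | ⟨m₄, x⟩⟩⟩⟩
    · exact absurd trivial (hno (.inl (true, fun _ => Classical.arbitrary _)))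
    · rcases m₁ with k | q
      · exact absurd rfl (hno (.inr ⟨k.1, Classical.arbitrary _⟩))
      · simp [IsNode] at hz
    · rcases m₁ with k | q <;> rcases m₂ with k₂ | q₂ <;> simp only [IsNode] at hz
      exact absurd ⟨hz, rfl⟩ (hno (.inr ⟨!k₂.1, Classical.arbitrary _⟩))
    · rcases m₁ with k | q <;> rcases m₂ with k₂ | q₂ <;> rcases m₃ with k₃ | q₃ <;>
        simp only [IsNode] at hz
      exact ⟨_, _, _, hz.1, hz.2, rfl⟩
    · simp [IsNode] at hz
  · rintro ⟨k, q, q', hq, hq', rfl⟩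
    refine ⟨⟨hq, hq'⟩, Finset.eq_empty_of_forall_notMem fun m hm => ?_⟩
    rw [mem_moves] at hm
    simpa using isNode_length hm

/-! ### The mechanism -/

theorem outcome_eq_of_suffix {i : Player} {x z : List (Move A)} {y : A i}
    (hx : x ∈ (Γ).decisionNodes (some i)) (hz : z ∈ (Γ).terminal)
    (h : (.inr ⟨i, y⟩ :: x) <:+ z) : outcome z i = y := by
  obtain ⟨k, q, q', hq, hq', rfl⟩ := mem_terminal.1 hz
  rcases mem_decisionNodes.1 hx with ⟨a, rfl⟩ | ⟨q₀, a, hq₀, rfl⟩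
  · simp only [List.suffix_cons_iff, List.cons.injEq, List.suffix_nil, reduceCtorEq, and_false,
      false_or, or_false, and_true, Sum.inr.injEq, Sum.inl.injEq] at h
    obtain ⟨rfl, rfl⟩ := h
    have : i ≠ q'.1 := by simp [hq']
    simp [outcome, Function.update_of_ne this]
  · simp only [List.suffix_cons_iff, List.cons.injEq, List.suffix_nil, reduceCtorEq, and_false,
      or_false, and_true, Sum.inr.injEq, Sum.inl.injEq] at h
    obtain ⟨rfl, rfl, rfl⟩ := h
    simp [outcome]

theorem exists_terminal {i : Player} {x : List (Move A)} (hx : x ∈ (Γ).decisionNodes (some i))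
    (y : A i) : ∃ z ∈ (Γ).terminal, (.inr ⟨i, y⟩ :: x) <:+ z := by
  rcases mem_decisionNodes.1 hx with ⟨a, rfl⟩ | ⟨q, a, hq, rfl⟩
  · exact ⟨_, mem_terminal.2 ⟨(i, a), ⟨i, y⟩, ⟨!i, Classical.arbitrary _⟩, rfl, rfl, rfl⟩,
      List.suffix_cons _ _⟩
  · exact ⟨_, mem_terminal.2 ⟨_, q, ⟨i, y⟩, hq, (Bool.not_not i).symm, rfl⟩, List.suffix_rfl⟩

/-- A second action provides the alternative that representation requires. Consequently all decision
nodes are pivotal. -/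
theorem represents_iff [∀ i, Nontrivial (A i)] {i : Player} {x : List (Move A)}
    (hx : x ∈ (Γ).decisionNodes (some i)) {m : Move A} {a : A i} :
    (Γ).Represents outcome i x m a ↔ m = .inr ⟨i, a⟩ := by
  constructor
  · rintro ⟨hm, h, -⟩
    obtain ⟨y, rfl⟩ := (mem_moves_of_decision hx).1 hm
    obtain ⟨z, hz, hs⟩ := exists_terminal hx y
    rw [← h z hz hs, outcome_eq_of_suffix hx hz hs]
  · rintro rfl
    obtain ⟨b, hb⟩ := exists_ne a
    obtain ⟨z, hz, hs⟩ := exists_terminal hx b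
    refine ⟨(mem_moves_of_decision hx).2 ⟨_, rfl⟩, fun z hz hs => outcome_eq_of_suffix hx hz hs,
      _, (mem_moves_of_decision hx).2 ⟨b, rfl⟩, z, hz, hs, ?_⟩
    rwa [outcome_eq_of_suffix hx hz hs]

theorem isMechanism [∀ i, Nontrivial (A i)] : (Γ).IsMechanism u outcome := by
  have hpiv : ∀ {i x}, x ∈ (Γ).decisionNodes (some i) → (Γ).IsPivotal outcome i x :=
    fun hx => ⟨hx, fun a => ⟨_, (represents_iff hx).2 rfl⟩⟩
  refine ⟨⟨fun a => ?_, fun z _ i => rfl⟩, fun i h _ x hx y hy m a => ?_, fun z hz i => ?_⟩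
  · refine ⟨_, mem_terminal.2 ⟨(true, a), ⟨true, a true⟩, ⟨false, a false⟩, rfl, rfl, rfl⟩, ?_⟩
    simp [outcome]
  · rw [represents_iff ((ExtensiveGame.mem_cell _).1 hx).1,
      represents_iff ((ExtensiveGame.mem_cell _).1 hy).1]
  · obtain ⟨x, hx, b, hs⟩ : ∃ x ∈ (Γ).decisionNodes (some i), ∃ b : A i,
        (.inr ⟨i, b⟩ :: x) <:+ z := by
      obtain ⟨⟨k, a⟩, ⟨j, b⟩, ⟨j', b'⟩, hq, hq', rfl⟩ := mem_terminal.1 hz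
      obtain rfl : j = k := hq
      obtain rfl : j' = !j := hq'
      rcases eq_or_eq_not i j with rfl | rfl
      · exact ⟨_, mem_decisionNodes.2 (Or.inl ⟨a, rfl⟩), b, List.suffix_cons _ _⟩
      · refine ⟨_, mem_decisionNodes.2 (Or.inr ⟨⟨j, b⟩, a, (Bool.not_not j).symm, rfl⟩), b', ?_⟩
        rw [Bool.not_not]
    refine ⟨x, _, hpiv hx, (represents_iff hx).2 ?_, hs⟩
    rw [outcome_eq_of_suffix hx hz hs]

end MediatedGame

namespace MediatedGame

open ExtensiveGame

variable {A : Player → Type u}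

/-- The decision node of player `j` that is reached if both players follow the recommendations. -/
noncomputable def pathNode (j : Player) (k : Player × (∀ j, A j)) : List (Move A) :=
  if k.1 = j then [.inl k] else [.inr ⟨k.1, k.2 k.1⟩, .inl k]

theorem pathNode_first (j : Player) (a : ∀ j, A j) : pathNode j (j, a) = [.inl (j, a)] :=
  if_pos rfl

theorem pathNode_second (j : Player) (a : ∀ j, A j) :
    pathNode j (!j, a) = [.inr ⟨!j, a (!j)⟩, .inl (!j, a)] :=
  if_neg (by simp)

theorem update_update_eq_joinProfile (a : ∀ j, A j) (i : Player) (x : A i) (y : A (!i)) :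
    Function.update (Function.update a i x) (!i) y = joinProfile i x y := by
  rw [← joinProfile_eta i (Function.update _ (!i) y), Function.update_self,
    Function.update_of_ne (by simp), Function.update_self]

theorem update_eq_joinProfile (a : ∀ j, A j) (i : Player) (x : A i) :
    Function.update a i x = joinProfile i x (a (!i)) := by
  rw [← joinProfile_eta i (Function.update a i x), Function.update_self,
    Function.update_of_ne (by simp)]

theorem pathNode_injective (j : Player) : Function.Injective (pathNode (A := A) j) := by
  intro k k' h
  unfold pathNode at h
  split_ifs at h <;> simp_all

variable [∀ i, Fintype (A i)] [∀ i, Nonempty (A i)]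
  {u : Player → (∀ j, A j) → ℝ} {p : ∀ i : Player, A i → A (!i)}
  {w : Player × (∀ j, A j) → ℝ} {hw : w ∈ stdSimplex ℝ (Player × (∀ j, A j))}

local notation "Γ" => game u p w hw

/-! ### Following the recommendations -/

theorem inr_mem_infoMoves {i : Player} {h : Σ j, A j} (hh : h ∈ (Γ).infoSets i) :
    (.inr h : Move A) ∈ (Γ).infoMoves i h := by
  refine (mem_infoMoves hh).2 ?_
  obtain rfl := mem_infoSets.1 hh
  exact ⟨h.2, rfl⟩

variable (u p w hw) in
/-- The pure strategy of following the recommendations. -/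
def followPure (i : Player) : (Γ).PureStrategy i := fun h => ⟨.inr h.1, inr_mem_infoMoves h.2⟩

open Classical in
variable (u p w hw) in
/-- The profile in which both players follow the recommendations. -/
noncomputable def follow : (Γ).StrategyProfile := fun i => Pi.single (followPure u p w hw i) 1

local notation "σ₀" => follow u p w hw

theorem follow_isMixed : (Γ).IsMixed σ₀ := fun i => by
  classical
  refine ⟨fun s => ?_, ?_⟩
  · rw [follow, Pi.single_apply]
    split_ifs <;> simp
  · simp [follow]

/-- The strategy is pure, so both branches of `stepProb` reduce to its prescription. This covers
nodes after deviations too. -/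
theorem stepProb_follow {i : Player} {x : List (Move A)} (hx : x ∈ (Γ).decisionNodes (some i))
    (q : Σ j, A j) [Decidable (q = recommendation p x)] :
    (Γ).stepProb σ₀ x (.inr q) = if q = recommendation p x then 1 else 0 := by
  have hP : Prescribes (followPure u p w hw i) x (.inr q) ↔ q = recommendation p x := by
    rw [prescribes_iff (label_mem_infoSets hx)]
    simp only [followPure, Sum.inr.injEq, eq_comm]
    rfl
  unfold stepProb
  rw [((ExtensiveGame.mem_decisionNodes _).1 hx).2]
  simp only [follow, strategyProb_single, hP]
  split_ifs <;> simp_all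

theorem reachProb_drawn {σ : (Γ).StrategyProfile} (hσ : (Γ).IsMixed σ)
    (χ : List (Move A) → Move A → ℝ) (k : Player × (∀ j, A j)) :
    (Γ).reachProb σ χ [.inl k] = χ [] (.inl k) := by
  have : ∀ i, strategyProb (σ i) (fun s => AllowsNode s [.inl k]) = 1 := fun i =>
    strategyProb_true (hσ i).2 fun s => by simp [AllowsNode, game, mover]
  rw [reachProb, prod_player true, this, this]
  simp [natureProb, game, mover]

theorem drawn_mem (i : Player) (a : ∀ j, A j) : [.inl (i, a)] ∈ (Γ).decisionNodes (some i) :=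
  mem_decisionNodes.2 (Or.inl ⟨a, rfl⟩)

theorem second_mem (k : Player × (∀ j, A j)) {q : Σ j, A j} (hq : q.1 = k.1) :
    [.inr q, .inl k] ∈ (Γ).decisionNodes (some (!k.1)) :=
  mem_decisionNodes.2 (Or.inr ⟨q, k.2, by simp [hq], by simp⟩)

/-- The second mover has not acted yet, so only the draw and the first action count. General `σ` and
`χ` are needed for the trembles. -/
theorem reachProb_second {σ : (Γ).StrategyProfile} (hσ : (Γ).IsMixed σ)
    (χ : List (Move A) → Move A → ℝ) (k : Player × (∀ j, A j)) (q : Σ j, A j) :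
    (Γ).reachProb σ χ [.inr q, .inl k] =
      χ [] (.inl k) * strategyProb (σ k.1) (fun s => Prescribes s [.inl k] (.inr q)) := by
  have h2 : strategyProb (σ (!k.1)) (fun s => AllowsNode s [.inr q, .inl k]) = 1 :=
    strategyProb_true (hσ _).2 fun s => by simp [AllowsNode, game, mover]
  rw [reachProb, prod_player k.1, h2]
  simp [natureProb, AllowsNode, game, mover]

theorem reachProb_follow_drawn (k : Player × (∀ j, A j)) :
    (Γ).reachProb σ₀ (Γ).chance [.inl k] = w k :=
  reachProb_drawn follow_isMixed _ k

open Classical in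
theorem reachProb_follow_second (k : Player × (∀ j, A j)) (q : Σ j, A j) :
    (Γ).reachProb σ₀ (Γ).chance [.inr q, .inl k] = if q = ⟨k.1, k.2 k.1⟩ then w k else 0 := by
  rw [reachProb_cons follow_isMixed, reachProb_follow_drawn, stepProb_follow (drawn_mem k.1 k.2),
    mul_ite, mul_one, mul_zero]
  rfl

open Classical in
theorem reachProb_follow_terminal (k : Player × (∀ j, A j)) {q : Σ j, A j} (hq : q.1 = k.1)
    (q' : Σ j, A j) :
    (Γ).reachProb σ₀ (Γ).chance [.inr q', .inr q, .inl k] =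
      if q = ⟨k.1, k.2 k.1⟩ ∧ q' = ⟨!k.1, k.2 (!k.1)⟩ then w k else 0 := by
  rw [reachProb_cons follow_isMixed, reachProb_follow_second, stepProb_follow (second_mem k hq)]
  by_cases h : q = ⟨k.1, k.2 k.1⟩ <;> simp [recommendation, h]

open Classical in
/-- Following the recommendations induces the distribution of the intended profile. -/
theorem sum_terminal_follow (a : ∀ j, A j) :
    (∑ z ∈ (Γ).terminal, if outcome z = a then (Γ).reachProb σ₀ (Γ).chance z else 0) =
      ∑ i, w (i, a) := by
  -- The obedient path for each first mover; all other terminal nodes contribute zero.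
  let c : Player → List (Move A) := fun i => [.inr ⟨!i, a (!i)⟩, .inr ⟨i, a i⟩, .inl (i, a)]
  have hout : ∀ i, outcome (c i) = a := fun i => by
    simp only [c, outcome, Function.update_eq_self]
  have hsub : Finset.univ.image c ⊆ (Γ).terminal := fun z hz => by
    obtain ⟨i, -, rfl⟩ := Finset.mem_image.1 hz
    exact mem_terminal.2 ⟨_, _, _, rfl, rfl, rfl⟩
  rw [← Finset.sum_subset hsub, Finset.sum_image]
  · refine Finset.sum_congr rfl fun i _ => ?_
    rw [if_pos (hout i), reachProb_follow_terminal _ rfl]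
    simp
  · intro i _ j _ h
    simp only [c, List.cons.injEq, Sum.inl.injEq, Prod.mk.injEq] at h
    exact h.2.2.1.1
  · intro z hz hzc
    obtain ⟨⟨i, b⟩, q, q', hq, hq', rfl⟩ := mem_terminal.1 hz
    rw [reachProb_follow_terminal _ hq]
    split_ifs with h1 h2
    · obtain ⟨rfl, rfl⟩ := h2
      refine absurd (Finset.mem_image.2 ⟨i, Finset.mem_univ _, ?_⟩) hzc
      have hb : outcome [.inr ⟨!i, b (!i)⟩, .inr ⟨i, b i⟩, .inl (i, b)] = b := by
        simp only [outcome, Function.update_eq_self]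
      rw [hb] at h1
      subst h1
      rfl
    · rfl
    · rfl

/-! ### Continuation payoffs -/

theorem continuationPayoff_second (j : Player) (k : Player × (∀ j, A j)) {q q' : Σ j, A j}
    (hq : q.1 = k.1) (hq' : q'.1 = !k.1) :
    (Γ).continuationPayoff σ₀ j [.inr q', .inr q, .inl k] =
      u j (outcome [.inr q', .inr q, .inl k]) :=
  continuationPayoff_eq_of_prob_one follow_isMixed j (mem_terminal.2 ⟨k, q, q', hq, hq', rfl⟩)
    List.suffix_rfl (continuationProb_self _)

theorem continuationPayoff_first (j : Player) (k : Player × (∀ j, A j)) {q : Σ j, A j}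
    (hq : q.1 = k.1) :
    (Γ).continuationPayoff σ₀ j [.inr q, .inl k] =
      u j (outcome [.inr (recommendation p [.inr q, .inl k]), .inr q, .inl k]) := by
  classical
  refine continuationPayoff_eq_of_prob_one follow_isMixed j (mem_terminal.2
    ⟨k, q, _, hq, recommendation_fst (second_mem (u := u) (p := p) (w := w) (hw := hw) k hq), rfl⟩)
    (List.suffix_cons _ _) ?_
  rw [continuationProb_cons List.suffix_rfl, continuationProb_self,
    stepProb_follow (second_mem k hq), if_pos rfl, one_mul]

/-- The link between the two descriptions of play: it lets the Nash condition of the mediated game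
be read at information sets. -/
theorem continuationPayoff_pathNode (j : Player) (k : Player × (∀ j, A j)) (d : A j → A j) :
    (Γ).continuationPayoff σ₀ j (.inr ⟨j, d (k.2 j)⟩ :: pathNode j k) =
      u j (mediatedOutcome p (Function.update (fun _ => id) j d) k.2 k.1) := by
  obtain ⟨i, a⟩ := k
  rw [mediatedOutcome_update]
  rcases eq_or_eq_not i j with rfl | rfl
  · rw [pathNode_first, continuationPayoff_first _ _ rfl, if_pos rfl]
    by_cases h : d (a i) = a i
    · have hr : recommendation p [.inr ⟨i, a i⟩, .inl (i, a)] = ⟨!i, a (!i)⟩ := if_pos rfl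
      rw [if_pos h, h, hr]
      simp only [outcome, Function.update_eq_self]
    · have h' : (⟨i, d (a i)⟩ : Σ j, A j) ≠ ⟨i, a i⟩ := fun he => h (by simpa using he)
      have hr : recommendation p [.inr ⟨i, d (a i)⟩, .inl (i, a)] = ⟨!i, p i (d (a i))⟩ :=
        if_neg h'
      rw [if_neg h, hr]
      simp only [outcome, update_update_eq_joinProfile]
  · rw [pathNode_second, continuationPayoff_second _ _ rfl (Bool.not_not j).symm, if_neg (by simp)]
    simp only [outcome, Function.update_eq_self, update_eq_joinProfile]

theorem pathNode_mem_cell (j : Player) (k : Player × (∀ j, A j)) :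
    pathNode j k ∈ (Γ).cell j ⟨j, k.2 j⟩ := by
  rw [mem_cell]
  obtain ⟨i, a⟩ := k
  rcases eq_or_eq_not i j with rfl | rfl
  · rw [pathNode_first]
    exact ⟨drawn_mem i a, rfl⟩
  · rw [pathNode_second]
    refine ⟨mem_decisionNodes.2 (Or.inr ⟨_, a, rfl, rfl⟩), ?_⟩
    change recommendation p [.inr ⟨!j, a (!j)⟩, .inl (!j, a)] = ⟨j, a j⟩
    simp only [recommendation, if_true]
    rw [Bool.not_not]

theorem reachProb_pathNode (j : Player) (k : Player × (∀ j, A j)) :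
    (Γ).reachProb σ₀ (Γ).chance (pathNode j k) = w k := by
  unfold pathNode
  split_ifs
  · exact reachProb_follow_drawn k
  · rw [reachProb_follow_second, if_pos rfl]

theorem eq_pathNode {j : Player} {x : List (Move A)} (hx : x ∈ (Γ).decisionNodes (some j))
    (h0 : (Γ).reachProb σ₀ (Γ).chance x ≠ 0) : ∃ k, x = pathNode j k := by
  rcases mem_decisionNodes.1 hx with ⟨a, rfl⟩ | ⟨q, a, hq, rfl⟩
  · exact ⟨_, (pathNode_first j a).symm⟩
  · rw [reachProb_follow_second] at h0
    split_ifs at h0 with h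
    · exact ⟨_, by rw [h, ← pathNode_second]⟩
    · exact absurd rfl h0

-- The nodes of the information set that can be reached under obedience are path nodes, one for each
-- draw that recommends `r` to `j`.
open Classical in
theorem sum_cell_follow (j : Player) (r : A j) (F : List (Move A) → ℝ) :
    ∑ x ∈ (Γ).cell j ⟨j, r⟩, (Γ).reachProb σ₀ (Γ).chance x * F x =
      ∑ k : Player × (∀ j, A j), if k.2 j = r then w k * F (pathNode j k) else 0 := by
  rw [← Finset.sum_filter, ← Finset.sum_subset
    (s₁ := (Finset.univ.filter fun k : Player × (∀ j, A j) => k.2 j = r).image (pathNode j)),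
    Finset.sum_image (pathNode_injective j).injOn]
  · exact Finset.sum_congr rfl fun k _ => by rw [reachProb_pathNode]
  · intro x hx
    obtain ⟨k, hk, rfl⟩ := Finset.mem_image.1 hx
    rw [← (Finset.mem_filter.1 hk).2]
    exact pathNode_mem_cell j k
  · intro x hx hxk
    by_contra h0
    obtain ⟨hxd, hxl⟩ := (mem_cell _).1 hx
    obtain ⟨k, rfl⟩ := eq_pathNode hxd (left_ne_zero_of_mul h0)
    have hl := ((mem_cell _).1 (pathNode_mem_cell (u := u) (p := p) (w := w) (hw := hw) j k)).2
    rw [hxl] at hl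
    refine hxk (Finset.mem_image.2 ⟨k, Finset.mem_filter.2 ⟨Finset.mem_univ _, ?_⟩, rfl⟩)
    simpa using hl.symm

end MediatedGame

/-! ### Sufficiency: beliefs and equilibrium. -/

namespace MediatedGame

open ExtensiveGame

variable {A : Player → Type u}

/-! ### Unexpected recommendations -/

/-- The recommendation is received with positive probability. -/
def OnPath (w : Player × (∀ j, A j) → ℝ) (h : Σ j, A j) : Prop :=
  ∃ k, 0 < w k ∧ k.2 h.1 = h.2

/-- The draw that a player who receives an unexpected recommendation believes in: he moves first
and his opponent is intended to answer according to `c`. -/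
def hopefulDraw (c : ∀ i : Player, A i → A (!i)) (h : Σ j, A j) : Player × (∀ j, A j) :=
  (h.1, joinProfile h.1 h.2 (c h.1 h.2))

open Classical in
/-- Perturbed weights of the draws, before normalization. The hopeful draws of player `i` are an
order of magnitude more likely than the other unexpected ones. -/
noncomputable def drawWeight (w : Player × (∀ j, A j) → ℝ)
    (c : ∀ i : Player, A i → A (!i)) (i : Player) (e : ℝ) (k : Player × (∀ j, A j)) : ℝ :=
  w k + e * (if ∃ r, ¬ OnPath w ⟨i, r⟩ ∧ k = hopefulDraw c ⟨i, r⟩ then 1 else 0) + e ^ 2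

theorem sq_le_drawWeight (w : Player × (∀ j, A j) → ℝ) (c : ∀ i : Player, A i → A (!i))
    (i : Player) {e : ℝ} (h0 : 0 < e) (k : Player × (∀ j, A j)) :
    w k + e ^ 2 ≤ drawWeight w c i e k := by
  unfold drawWeight
  split_ifs <;> linarith

variable [∀ i, Fintype (A i)] {u : Player → (∀ j, A j) → ℝ} {p : ∀ i : Player, A i → A (!i)}
  {w : Player × (∀ j, A j) → ℝ} {c : ∀ i : Player, A i → A (!i)}

variable (w c) in
/-- The perturbed choice probabilities of Nature. -/
noncomputable def drawTremble (i : Player) (e : ℝ) : List (Move A) → Move A → ℝ :=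
  drawProb fun k => drawWeight w c i e k / ∑ k', drawWeight w c i e k'

theorem one_le_sum_drawWeight (hw : w ∈ stdSimplex ℝ (Player × (∀ j, A j))) (i : Player) {e : ℝ}
    (h0 : 0 < e) : 1 ≤ ∑ k, drawWeight w c i e k := by
  rw [← hw.2]
  exact Finset.sum_le_sum fun k _ =>
    (le_add_of_nonneg_right (sq_nonneg e)).trans (sq_le_drawWeight w c i h0 k)

theorem drawTremble_nil_pos (hw : w ∈ stdSimplex ℝ (Player × (∀ j, A j))) (i : Player) {e : ℝ}
    (h0 : 0 < e) (x : List (Move A)) (k : Player × (∀ j, A j)) :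
    0 < drawTremble w c i e x (.inl k) :=
  div_pos ((add_pos_of_nonneg_of_pos (hw.1 k) (pow_pos h0 2)).trans_le (sq_le_drawWeight w c i h0 k))
    (one_pos.trans_le (one_le_sum_drawWeight hw i h0))

theorem sum_drawTremble (hw : w ∈ stdSimplex ℝ (Player × (∀ j, A j))) (i : Player) {e : ℝ}
    (h0 : 0 < e) (x : List (Move A)) : ∑ k, drawTremble w c i e x (.inl k) = 1 := by
  change ∑ k, drawWeight w c i e k / ∑ k', drawWeight w c i e k' = 1
  rw [← Finset.sum_div, div_self (one_pos.trans_le (one_le_sum_drawWeight hw i h0)).ne']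

theorem drawTremble_le_one (hw : w ∈ stdSimplex ℝ (Player × (∀ j, A j))) (i : Player) {e : ℝ}
    (h0 : 0 < e) (x : List (Move A)) (k : Player × (∀ j, A j)) :
    drawTremble w c i e x (.inl k) ≤ 1 := by
  rw [← sum_drawTremble (c := c) hw i h0 x]
  exact Finset.single_le_sum (fun k _ => (drawTremble_nil_pos hw i h0 x k).le) (Finset.mem_univ k)

variable [∀ i, Nonempty (A i)] {hw : w ∈ stdSimplex ℝ (Player × (∀ j, A j))}

local notation "Γ" => game u p w hw
local notation "σ₀" => follow u p w hw

/-! ### Beliefs -/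

open Classical in
variable (u p w hw) in
/-- The beliefs, up to normalization. -/
noncomputable def beliefWeight (c : ∀ i : Player, A i → A (!i)) (h : Σ j, A j)
    (x : List (Move A)) : ℝ :=
  if OnPath w h then (Γ).reachProb σ₀ (Γ).chance x else
    if x = [.inl (hopefulDraw c h)] then 1 else 0

variable (u p w hw) in
/-- The beliefs of the players. -/
noncomputable def belief (c : ∀ i : Player, A i → A (!i)) (i : Player) (h : Σ j, A j)
    (x : List (Move A)) : ℝ :=
  beliefWeight u p w hw c h x / ∑ y ∈ (Γ).cell i h, beliefWeight u p w hw c h y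

theorem beliefWeight_nonneg {i : Player} {h : Σ j, A j} {x : List (Move A)}
    (hx : x ∈ (Γ).cell i h) : 0 ≤ beliefWeight u p w hw c h x := by
  unfold beliefWeight
  split_ifs
  · exact reachProb_nonneg follow_isMixed (Γ).chance_nonneg (mem_nodes_of_mem_cell hx)
  · exact zero_le_one
  · exact le_rfl

theorem hopefulDraw_mem_cell (i : Player) (r : A i) :
    [.inl (hopefulDraw c ⟨i, r⟩)] ∈ (Γ).cell i ⟨i, r⟩ := by
  refine (mem_cell _).2 ⟨drawn_mem _ _, ?_⟩
  change (⟨i, joinProfile i r (c i r) i⟩ : Σ j, A j) = _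
  rw [joinProfile_self]

theorem sum_beliefWeight_pos {i : Player} {h : Σ j, A j} (hh : h ∈ (Γ).infoSets i) :
    0 < ∑ x ∈ (Γ).cell i h, beliefWeight u p w hw c h x := by
  classical
  obtain ⟨i, r⟩ := h
  obtain rfl := mem_infoSets.1 hh
  by_cases hon : OnPath w ⟨i, r⟩
  · have := sum_cell_follow (u := u) (p := p) (w := w) (hw := hw) i r fun _ => 1
    simp only [mul_one] at this
    simp only [beliefWeight, if_pos hon, this]
    obtain ⟨k, hk, hkr⟩ := hon
    refine Finset.sum_pos' (fun k _ => ?_) ⟨k, Finset.mem_univ _, by rwa [if_pos hkr]⟩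
    split_ifs
    exacts [hw.1 k, le_rfl]
  · simp only [beliefWeight, if_neg hon]
    rw [Finset.sum_ite_eq', if_pos (hopefulDraw_mem_cell i r)]
    exact one_pos

theorem isBeliefSystem : (Γ).IsBeliefSystem (belief u p w hw c) := fun i h hh => by
  have hpos := sum_beliefWeight_pos (c := c) hh
  refine ⟨fun x hx => div_nonneg (beliefWeight_nonneg hx) hpos.le, ?_⟩
  simp only [belief]
  rw [← Finset.sum_div, div_self hpos.ne']

/-! ### Sequential rationality -/

theorem sum_beliefWeight_le
    (hNash : ∀ (j : Player) (d : A j → A j),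
      ∑ k, w k * u j (mediatedOutcome p (Function.update (fun _ => id) j d) k.2 k.1) ≤
        ∑ k, w k * u j k.2)
    (hp : ∀ i x b, u i (joinProfile i x (p i x)) ≤ u i (joinProfile i x b))
    (hc : ∀ i x b, u i (joinProfile i x b) ≤ u i (joinProfile i x (c i x)))
    (hu : NoAbsolutelyDominated u) (i : Player) (r y : A i) :
    ∑ x ∈ (Γ).cell i ⟨i, r⟩, beliefWeight u p w hw c ⟨i, r⟩ x *
        (Γ).continuationPayoff σ₀ i (.inr ⟨i, y⟩ :: x) ≤
      ∑ x ∈ (Γ).cell i ⟨i, r⟩, beliefWeight u p w hw c ⟨i, r⟩ x *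
        (Γ).continuationPayoff σ₀ i (.inr ⟨i, r⟩ :: x) := by
  classical
  by_cases hon : OnPath w ⟨i, r⟩
  · simp only [beliefWeight, if_pos hon]
    rw [sum_cell_follow i r fun x => (Γ).continuationPayoff σ₀ i (.inr ⟨i, y⟩ :: x),
      sum_cell_follow i r fun x => (Γ).continuationPayoff σ₀ i (.inr ⟨i, r⟩ :: x),
      ← sub_nonneg, ← Finset.sum_sub_distrib]
    -- This deviation alters the answer to `r` only, so the terms of all other recommendations
    -- cancel.
    refine (sub_nonneg.2 (hNash i fun x => if x = r then y else x)).trans_eq ?_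
    rw [← Finset.sum_sub_distrib]
    refine Finset.sum_congr rfl fun k _ => ?_
    by_cases hk : k.2 i = r
    · have h1 := continuationPayoff_pathNode (u := u) (p := p) (w := w) (hw := hw) i k
        fun x => if x = r then y else x
      have h2 := continuationPayoff_pathNode (u := u) (p := p) (w := w) (hw := hw) i k id
      rw [mediatedOutcome_update_of_eq p (by rfl)] at h2
      simp only [hk, if_true, id] at h1 h2
      rw [if_pos hk, if_pos hk, h1, h2]
    · have h1 := mediatedOutcome_update_of_eq p (d := fun x => if x = r then y else x) (a := k.2)
        (if_neg hk) k.1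
      rw [if_neg hk, if_neg hk, h1, sub_self, sub_self]
  · have hcell := hopefulDraw_mem_cell (u := u) (p := p) (w := w) (hw := hw) (c := c) i r
    simp only [beliefWeight, if_neg hon, ite_mul, one_mul, zero_mul, Finset.sum_ite_eq', hcell,
      if_true]
    -- At the hopeful draw the player moves first: obedience is answered by his favourite `c i r`,
    -- disobedience by the punishment `p i y`.
    have hV : ∀ y, (Γ).continuationPayoff σ₀ i (.inr ⟨i, y⟩ :: [.inl (hopefulDraw c ⟨i, r⟩)]) =
        u i (if y = r then joinProfile i r (c i r) else joinProfile i y (p i y)) := fun y => by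
      have h1 := continuationPayoff_pathNode (u := u) (p := p) (w := w) (hw := hw) i
        (hopefulDraw c ⟨i, r⟩) fun _ => y
      simpa [hopefulDraw, pathNode_first, mediatedOutcome_update, joinProfile_self] using h1
    rw [hV, hV, if_pos rfl]
    split_ifs with hy
    · exact le_rfl
    -- That `y` does not absolutely dominate `r` gives `b`, `b'` with `u_i(y, b) ≤ u_i(r, b')`,
    -- which separate the worst payoff of `y` from the best payoff of `r`.
    · have h := hu i r
      simp only [AbsolutelyDominates, not_exists, not_forall, not_lt] at h
      obtain ⟨b, b', hb⟩ := h y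
      exact (hp i y b).trans (hb.trans (hc i r b'))

theorem sequentiallyRational
    (hNash : ∀ (j : Player) (d : A j → A j),
      ∑ k, w k * u j (mediatedOutcome p (Function.update (fun _ => id) j d) k.2 k.1) ≤
        ∑ k, w k * u j k.2)
    (hp : ∀ i x b, u i (joinProfile i x (p i x)) ≤ u i (joinProfile i x b))
    (hc : ∀ i x b, u i (joinProfile i x b) ≤ u i (joinProfile i x (c i x)))
    (hu : NoAbsolutelyDominated u) :
    (Γ).SequentiallyRational (belief u p w hw c) σ₀ := by
  classical
  rintro i ⟨⟨i', r⟩, hh⟩ s hs m hm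
  obtain rfl := mem_infoSets.1 hh
  obtain rfl : s = followPure u p w hw i' := by
    by_contra hne
    rw [follow, Pi.single_apply, if_neg hne] at hs
    exact lt_irrefl _ hs
  obtain ⟨y, rfl⟩ := (mem_infoMoves hh).1 hm
  have key := sum_beliefWeight_le (hw := hw) hNash hp hc hu i' r y
  have hpos := sum_beliefWeight_pos (c := c) hh
  simp only [interimPayoff, belief, div_mul_eq_mul_div]
  rw [← Finset.sum_div, ← Finset.sum_div]
  exact div_le_div_of_nonneg_right key hpos.le

/-! ### Weak consistency -/

variable (u p w hw) in
/-- Perturbed strategies. -/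
noncomputable def tremble (e : ℝ) : (Γ).StrategyProfile :=
  fun i s => (1 - e) * σ₀ i s + e / Fintype.card ((Γ).PureStrategy i)

theorem tremble_isStrictlyMixed {e : ℝ} (h0 : 0 < e) (h1 : e ≤ 1) :
    (Γ).IsStrictlyMixed (tremble u p w hw e) := by
  have hne : ∀ i, Nonempty ((Γ).PureStrategy i) := fun i => ⟨followPure u p w hw i⟩
  have hpos : ∀ i s, 0 < tremble u p w hw e i s := fun i s =>
    add_pos_of_nonneg_of_pos
      (mul_nonneg (sub_nonneg.2 h1) ((follow_isMixed (u := u) (p := p) (hw := hw) i).1 s))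
      (div_pos h0 (Nat.cast_pos.2 Fintype.card_pos))
  refine ⟨fun i => ⟨fun s => (hpos i s).le, ?_⟩, hpos⟩
  have hcard : (Fintype.card ((Γ).PureStrategy i) : ℝ) ≠ 0 := Nat.cast_ne_zero.2 Fintype.card_ne_zero
  simp only [tremble]
  rw [Finset.sum_add_distrib, ← Finset.mul_sum, (follow_isMixed i).2, Finset.sum_const,
    Finset.card_univ, nsmul_eq_mul]
  field_simp
  ring

theorem strategyProb_tremble_le {e : ℝ} (h0 : 0 < e) {i : Player}
    {P : (Γ).PureStrategy i → Prop} (hP : ¬ P (followPure u p w hw i)) :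
    strategyProb (tremble u p w hw e i) P ≤ e := by
  classical
  have hne : Nonempty ((Γ).PureStrategy i) := ⟨followPure u p w hw i⟩
  have hcard : (Fintype.card ((Γ).PureStrategy i) : ℝ) ≠ 0 := Nat.cast_ne_zero.2 Fintype.card_ne_zero
  calc strategyProb (tremble u p w hw e i) P
      ≤ ∑ _s : (Γ).PureStrategy i, e / Fintype.card ((Γ).PureStrategy i) := by
        refine Finset.sum_le_sum fun s _ => ?_
        split_ifs with hs
        · have : s ≠ followPure u p w hw i := by
            rintro rfl
            exact hP hs
          simp [tremble, follow, this]
        · positivity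
    _ = e := by
        rw [Finset.sum_const, Finset.card_univ, nsmul_eq_mul]
        field_simp

theorem moves_nil : (Γ).moves [] = Finset.univ.map ⟨Sum.inl, Sum.inl_injective⟩ := by
  ext (k | q) <;> simp [mem_moves, IsNode]

theorem drawTremble_isStrictlyMixedNature (i : Player) {e : ℝ} (h0 : 0 < e) :
    (Γ).IsStrictlyMixedNature (drawTremble w c i e) := fun x hx => by
  obtain rfl := mem_decisionNodes_none hx
  rw [moves_nil]
  refine ⟨fun m hm => ?_, ?_⟩
  · obtain ⟨k, -, rfl⟩ := Finset.mem_map.1 hm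
    exact drawTremble_nil_pos hw i h0 [] k
  · rw [Finset.sum_map]
    exact sum_drawTremble hw i h0 []

/-- At an unexpected recommendation, all nodes but the hopeful draw are very unlikely. -/
theorem reachProb_tremble_le {e : ℝ} (h0 : 0 < e) (h1 : e ≤ 1) {i : Player} {r : A i}
    (hoff : ¬ OnPath w ⟨i, r⟩) {x : List (Move A)} (hx : x ∈ (Γ).cell i ⟨i, r⟩)
    (hne : x ≠ [.inl (hopefulDraw c ⟨i, r⟩)]) :
    (Γ).reachProb (tremble u p w hw (e ^ 2)) (drawTremble w c i e) x ≤ e ^ 2 := by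
  have hmix := (tremble_isStrictlyMixed (u := u) (p := p) (hw := hw) (pow_pos h0 2)
    (pow_le_one₀ h0.le h1)).1
  have hw0 : ∀ k : Player × (∀ j, A j), k.2 i = r → w k = 0 := fun k hk =>
    le_antisymm (not_lt.1 fun hpos => hoff ⟨k, hpos, hk⟩) (hw.1 k)
  have hdraw : ∀ k : Player × (∀ j, A j), k.2 i = r → k ≠ hopefulDraw c ⟨i, r⟩ →
      drawTremble w c i e [] (.inl k) ≤ e ^ 2 := by
    intro k hk hkne
    -- The hopeful draw for `r'` recommends `r'` to `i`, so only the one for `r` itself could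
    -- recommend `r`; the other draws carry weight `e ^ 2`.
    have hnot : ¬ ∃ r', ¬ OnPath w ⟨i, r'⟩ ∧ k = hopefulDraw c ⟨i, r'⟩ := by
      rintro ⟨r', -, rfl⟩
      change joinProfile i r' _ i = r at hk
      rw [joinProfile_self] at hk
      exact hkne (by rw [hk])
    change drawWeight w c i e k / _ ≤ _
    rw [drawWeight, hw0 k hk, if_neg hnot, mul_zero, zero_add, zero_add]
    exact div_le_self (sq_nonneg e) (one_le_sum_drawWeight hw i h0)
  obtain ⟨hxd, hxl⟩ := (mem_cell _).1 hx
  change recommendation p x = _ at hxl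
  rcases mem_decisionNodes.1 hxd with ⟨a, rfl⟩ | ⟨q, a, hq, rfl⟩
  · rw [reachProb_drawn hmix]
    have har : a i = r := by simpa [recommendation] using hxl
    exact hdraw _ har fun he => hne (by rw [he])
  · rw [reachProb_second hmix]
    -- If the opponent obeyed, the draw itself recommends `r`, and it is not hopeful because `i`
    -- moves second. If he disobeyed, the bound comes from his tremble of size `e ^ 2`.
    by_cases hqa : q = ⟨!i, a (!i)⟩
    · have har : a i = r := by
        simp only [recommendation, hqa, if_true] at hxl
        rw [Bool.not_not] at hxl
        simpa using hxl
      refine (mul_le_of_le_one_right (drawTremble_nil_pos hw i h0 _ _).le ?_).trans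
        (hdraw _ har fun he => ?_)
      · rw [← strategyProb_true (hmix (!i)).2 (P := fun _ => True) fun _ => trivial]
        exact strategyProb_mono (hmix _).1 fun _ _ => trivial
      · have := congrArg Prod.fst he
        simp [hopefulDraw] at this
    · refine (mul_le_of_le_one_left (strategyProb_nonneg (hmix _).1 _)
        (drawTremble_le_one hw i h0 _ _)).trans (strategyProb_tremble_le (pow_pos h0 2) ?_)
      rw [prescribes_iff (label_mem_infoSets (drawn_mem _ _))]
      intro he
      exact hqa (Sum.inr_injective he).symm

/-- Only the hopeful draws of `i` are favoured in his sequence: those of the opponent could surprise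
`i` as second mover with comparable probability. Strategies tremble at order `ε ^ 2`, so that a
deviation after a likely draw is still negligible against a hopeful draw of order `ε`. -/
theorem weaklyConsistent : (Γ).WeaklyConsistent (belief u p w hw c) σ₀ := by
  classical
  intro i
  let ε : ℕ → ℝ := fun n => 1 / ((n : ℝ) + 1)
  have hε0 : ∀ n, 0 < ε n := fun n => Nat.one_div_pos_of_nat
  have hε1 : ∀ n, ε n ≤ 1 := fun n => by
    rw [div_le_one (by positivity)]
    simp
  have hε : Tendsto ε atTop (𝓝 0) := tendsto_one_div_add_atTop_nhds_zero_nat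
  have hεsq : Tendsto (fun n => ε n ^ 2) atTop (𝓝 0) := by simpa using hε.pow 2
  have hmix := fun n => tremble_isStrictlyMixed (u := u) (p := p) (hw := hw) (pow_pos (hε0 n) 2)
    (pow_le_one₀ (hε0 n).le (hε1 n))
  have hσ : ∀ j s, Tendsto (fun n => tremble u p w hw (ε n ^ 2) j s) atTop (𝓝 (σ₀ j s)) := by
    intro j s
    have := ((hεsq.const_sub 1).mul_const (σ₀ j s)).add
      (hεsq.div_const (Fintype.card ((Γ).PureStrategy j) : ℝ))
    simpa [tremble] using this
  have hdw : ∀ k, Tendsto (fun n => drawWeight w c i (ε n) k) atTop (𝓝 (w k)) := by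
    intro k
    have := ((hε.mul_const (if ∃ r, ¬ OnPath w ⟨i, r⟩ ∧ k = hopefulDraw c ⟨i, r⟩
      then (1 : ℝ) else 0)).const_add (w k)).add hεsq
    simpa [drawWeight] using this
  have hN : Tendsto (fun n => ∑ k, drawWeight w c i (ε n) k) atTop (𝓝 1) := by
    rw [← hw.2]
    exact tendsto_finsetSum _ fun k _ => hdw k
  have hχ : ∀ x ∈ (Γ).decisionNodes none, ∀ m ∈ (Γ).moves x,
      Tendsto (fun n => drawTremble w c i (ε n) x m) atTop (𝓝 ((Γ).chance x m)) := by
    intro x hx m hm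
    obtain rfl := mem_decisionNodes_none hx
    rw [moves_nil] at hm
    obtain ⟨k, -, rfl⟩ := Finset.mem_map.1 hm
    have := (hdw k).div hN one_ne_zero
    rw [div_one] at this
    exact this
  refine ⟨fun n => tremble u p w hw (ε n ^ 2), fun n => drawTremble w c i (ε n), hmix,
    fun n => drawTremble_isStrictlyMixedNature i (hε0 n), hσ, hχ, fun h hh x hx => ?_⟩
  obtain ⟨i', r⟩ := h
  obtain rfl := mem_infoSets.1 hh
  have hpos := sum_beliefWeight_pos (c := c) hh
  by_cases hon : OnPath w ⟨i', r⟩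
  · refine tendsto_bayesBelief (ε := fun _ => 1) (fun _ => one_ne_zero) (fun y hy => ?_)
      hpos.ne' hx
    simp only [div_one, beliefWeight, if_pos hon]
    exact tendsto_reachProb hσ hχ (mem_nodes_of_mem_cell hy)
  -- Scaled by `ε`, the hopeful node has weight `(1 + ε) / N` with normalizing sum `N → 1`, and
  -- every other node of the cell has weight at most `ε`.
  · refine tendsto_bayesBelief (ε := ε) (fun n => (hε0 n).ne') (fun y hy => ?_) hpos.ne' hx
    simp only [beliefWeight, if_neg hon]
    split_ifs with hy0
    · subst hy0
      have hw0 : w (hopefulDraw c ⟨i', r⟩) = 0 :=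
        le_antisymm (not_lt.1 fun hpos => hon ⟨_, hpos, joinProfile_self ..⟩) (hw.1 _)
      have hlim := (hε.const_add 1).div hN one_ne_zero
      rw [add_zero, div_one] at hlim
      refine hlim.congr fun n => ?_
      rw [reachProb_drawn (hmix n).1]
      change _ = drawWeight w c i' (ε n) (hopefulDraw c ⟨i', r⟩) / _ / ε n
      rw [Pi.div_apply, drawWeight, hw0, if_pos ⟨r, hon, rfl⟩]
      have := (hε0 n).ne'
      have := (one_pos.trans_le (one_le_sum_drawWeight (c := c) hw i' (hε0 n))).ne'
      field_simp
      ring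
    · refine squeeze_zero (fun n => ?_) (fun n => ?_) hε
      · refine div_nonneg (reachProb_nonneg (hmix n).1 (fun z m hz hzn => ?_)
          (mem_nodes_of_mem_cell hy)) (hε0 n).le
        have hm := (ExtensiveGame.mem_moves _).2 hz
        exact ((drawTremble_isStrictlyMixedNature i' (hε0 n) z
          ((ExtensiveGame.mem_decisionNodes _).2 ⟨⟨m, hm⟩, hzn⟩)).1 m hm).le
      · rw [div_le_iff₀ (hε0 n), ← sq]
        exact reachProb_tremble_le (hε0 n) (hε1 n) hon hy hy0

end MediatedGame

open MediatedGame in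
/-- Without absolutely dominated actions, interdependent-choice equilibria are quasi-sequentially
implementable. -/
theorem IsICE.isQSImplementable {A : Player → Type u} [∀ i, Fintype (A i)]
    [∀ i, Nontrivial (A i)] {u : Player → (∀ j, A j) → ℝ} (hu : NoAbsolutelyDominated u)
    {α : (∀ j, A j) → ℝ} (h : IsICE u α) : IsQSImplementable u α := by
  classical
  obtain ⟨hα, θ, p, hθ, hp, hNash⟩ := h
  have hbest : ∀ (i : Player) (x : A i), ∃ b : A (!i), ∀ b',
      u i (joinProfile i x b') ≤ u i (joinProfile i x b) := fun i x =>
    Finite.exists_max fun b => u i (joinProfile i x b)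
  choose c hc using hbest
  -- Nature draws profile and first mover at once, so `w` is their joint law and its marginal on
  -- profiles is `α`.
  let w : Player × (∀ j, A j) → ℝ := fun k => α k.2 * θ k.2 k.1
  have hsum : ∀ F : (∀ j, A j) → Player → ℝ,
      ∑ k, w k * F k.2 k.1 = ∑ a, ∑ i, α a * θ a i * F a i := fun F => by
    rw [Fintype.sum_prod_type, Finset.sum_comm]
  have hmarg : ∀ a, ∑ i, w (i, a) = α a := fun a => by
    simp only [w]
    rw [← Finset.mul_sum, (hθ a).2, mul_one]
  have hw : w ∈ stdSimplex ℝ (Player × (∀ j, A j)) := by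
    refine ⟨fun k => mul_nonneg (hα.1 _) ((hθ _).1 _), ?_⟩
    rw [Fintype.sum_prod_type, Finset.sum_comm, ← hα.2]
    exact Finset.sum_congr rfl fun a _ => hmarg a
  refine ⟨_, _, game u p w hw, outcome, isMechanism, belief u p w hw c, follow u p w hw,
    ⟨isBeliefSystem, follow_isMixed, weaklyConsistent, sequentiallyRational (fun j d => ?_)
      (fun i x b => (hp i x).2 b (Or.inl trivial)) hc hu⟩, fun a => ?_⟩
  · have := hNash j d
    rw [mediatedPayoff, mediatedPayoff, ← hsum fun a i => u j (mediatedOutcome p _ a i),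
      ← hsum fun a i => u j (mediatedOutcome p _ a i)] at this
    simpa only [mediatedOutcome_id] using this
  · rw [sum_terminal_follow, hmarg]

theorem mainTheorem7 {A : Player → Type u} [∀ i, Fintype (A i)] [∀ i, Nontrivial (A i)]
    (u : Player → (∀ j, A j) → ℝ) (hu : NoAbsolutelyDominated u)
    (α : (∀ j, A j) → ℝ) (hα : α ∈ stdSimplex ℝ (∀ j, A j)) :
    IsQSImplementable u α ↔ IsICE u α :=
  ⟨fun h => h.isICE hα, fun h => h.isQSImplementable hu⟩
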